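/- Let $n\ge 0$, let $\eta,\alpha,\beta,\gamma,\delta\in\mathbb C$ with $\eta\neq0$, $\alpha\ne 0$, and let $d(\lambda)=(\alpha\delta-\beta\gamma)\lambda^{2n}+Q_1\lambda^{2n-1}+\dots+Q_{2n}$ be a polynomial with complex coefficients. On $\mathbb C^{2n}$ with coordinates $(\lambda_1,\dots,\lambda_n,\mu_1,\dots,\mu_n)$ put $$P_0=\begin{pmatrix}0&I\\-I&0\end{pmatrix},\quad P_1=\begin{pmatrix}0&\Lambda\\-\Lambda&0\end{pmatrix},\quad \Lambda=\mathrm{diag}(\lambda_1,\dots,\lambda_n),\quad N=P_1P_0^{-1},\quad P_k=N^kP_0 ,$$ and let $\{f,g\}_k=\sum_{a,b}P_k^{ab}\,\partial_af\,\partial_bg$ be the corresponding brackets of holomorphic functions. On the open set where $\lambda_1,\dots,\lambda_n$ are pairwise distinct let $T(\lambda)=\begin{pmatrix}A(\lambda)&B(\lambda)\\C(\lambda)&D(\lambda)\end{pmatrix}$ be given by $$A(\lambda)=\alpha\prod_{i=1}^n(\lambda-\lambda_i),\quad B(\lambda)=A(\lambda)\Bigl(\frac\beta\alpha+\sum_{i=1}^n\frac{e^{-\eta\mu_i}}{(\lambda-\lambda_i)A'(\lambda_i)}\Bigr),\quad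 C(\lambda)=A(\lambda)\Bigl(\frac\gamma\alpha-\sum_{i=1}^n\frac{d(\lambda_i)\,e^{\eta\mu_i}}{(\lambda-\lambda_i)A'(\lambda_i)}\Bigr),\quad D(\lambda)=\frac{d(\lambda)+B(\lambda)C(\lambda)}{A(\lambda)} .$$ Then the following hold. (1) For $k=0,\dots,n$ one has $P_k=\begin{pmatrix}0&\Lambda^k\\-\Lambda^k&0\end{pmatrix}$, that is, $\{\lambda_i,\lambda_j\}_k=\{\mu_i,\mu_j\}_k=0$ and $\{\lambda_i,\mu_j\}_k=\lambda_i^k\delta_{ij}$. (2) The brackets $\{\cdot,\cdot\}_k$, $k=0,\dots,n$, are Poisson brackets and pairwise compatible: every linear combination of two of them is a Poisson bracket, and the Schouten brackets $[\![P_k,P_l]\!]$ vanish for $0\le k,l\le n$. (3) $T(\lambda)$ is a matrix of polynomials of degree at most $n$ that depends holomorphically on the point; the coefficients of $\lambda^n$ in $A,B,C,D$ are $\alpha,\beta,\gamma,\delta$; moreover $\det T(\lambda)=d(\lambda)$, $A(\lambda_i)=0$ and $B(\lambda_i)=e^{-\eta\mu_i}$. With $T_1(\lambda)=T(\lambda)\otimes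 I$ and $T_2(\mu)=I\otimes T(\mu)$, one has for $k=0,\dots,n$ and all complex $\lambda\ne\mu$ $$\{T_1(\lambda),T_2(\mu)\}_k=r_{12}^{[k]}T_1(\lambda)T_2(\mu)-T_1(\lambda)T_2(\mu)r_{21}^{[k]}+T_1(\lambda)s_{12}^{[k]}T_2(\mu)-T_2(\mu)s_{21}^{[k]}T_1(\lambda),\qquad(*)$$ where $r_{12}^{[k]},r_{21}^{[k]},s_{12}^{[k]},s_{21}^{[k]}$ depend on $(\lambda,\mu)$ and have, in the ordered basis $e_1\otimes e_1,\ e_2\otimes e_1,\ e_1\otimes e_2,\ e_2\otimes e_2$ of $\mathbb C^2\otimes\mathbb C^2$, the matrices $$r^{[k]}_{12}=\frac{\eta}{\lambda-\mu}\begin{pmatrix}1&0&0&0\\0&1-\frac{\lambda^k+\mu^k}2&\mu^k&0\\0&\lambda^k&1-\frac{\lambda^k+\mu^k}2&0\\0&\rho_C^{[k]}&-\rho_C^{[k]}&1\end{pmatrix},\qquad r^{[k]}_{21}=\frac{\eta}{\lambda-\mu}\begin{pmatrix}1&0&0&0\\0&1-\frac{\lambda^k+\mu^k}2&\lambda^k&\rho_B^{[k]}\\0&\mu^k&1-\frac{\lambda^k+\mu^k}2&-\rho_B^{[k]}\\0&0&0&1\end{pmatrix},$$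 $$s^{[k]}_{12}=\frac{\eta}{\lambda-\mu}\begin{pmatrix}0&-\rho_B^{[k]}&0&0\\0&\frac{\lambda^k-\mu^k}2&0&0\\-\rho_C^{[k]}&-\rho_D^{[k]}&\frac{\lambda^k-\mu^k}2&0\\0&0&0&0\end{pmatrix},\qquad s^{[k]}_{21}=\Pi s^{[k]}_{12}\Pi,$$ $\Pi$ is the permutation operator of $\mathbb C^2\otimes\mathbb C^2$, and for $X=B,C,D$ $$\rho^{[k]}_X=q_X^{[k]}(\lambda)-q_X^{[k]}(\mu),\qquad q_X^{[k]}(\lambda)\ \text{the polynomial quotient of the Euclidean division of}\ \lambda^kX(\lambda)\ \text{by}\ A(\lambda).$$ (4) For every matrix $T(\lambda)$ of polynomials of degree at most $n$ whose entry $A$ has degree exactly $n$, the right-hand side of $(*)$ is for $k=0$ the Sklyanin bracket $\bigl[\tfrac{\eta}{\lambda-\mu}\Pi,\,T_1(\lambda)T_2(\mu)\bigr]$, and for $k=1$ it is the bracket $\{\cdot,\cdot\}_1$ which is skew-symmetric and satisfies, with $\alpha,\beta,\gamma,\delta$ the coefficients of $\lambda^n$ in $A,B,C,D$, $$\{A(\lambda),A(\mu)\}_1=\{B(\lambda),B(\mu)\}_1=\{C(\lambda),C(\mu)\}_1=0,$$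 $$\{B(\lambda),A(\mu)\}_1=\tfrac{\eta}{\lambda-\mu}\bigl(\lambda B(\lambda)A(\mu)-\mu B(\mu)A(\lambda)\bigr)-\tfrac{\eta\beta}{\alpha}A(\lambda)A(\mu),$$ $$\{C(\lambda),A(\mu)\}_1=\tfrac{-\eta}{\lambda-\mu}\bigl(\lambda C(\lambda)A(\mu)-\mu C(\mu)A(\lambda)\bigr)+\tfrac{\eta\gamma}{\alpha}A(\lambda)A(\mu),$$ $$\{B(\lambda),C(\mu)\}_1=\tfrac{\eta}{\lambda-\mu}\bigl(\lambda D(\lambda)A(\mu)-\mu D(\mu)A(\lambda)\bigr)-\tfrac{\eta\delta}{\alpha}A(\lambda)A(\mu),$$ $$\{B(\lambda),D(\mu)\}_1=\tfrac{-\eta\lambda}{\lambda-\mu}\bigl(B(\lambda)D(\mu)-B(\mu)D(\lambda)\bigr)+\eta A(\lambda)\bigl(\tfrac\beta\alpha D(\mu)-\tfrac\delta\alpha B(\mu)\bigr),$$ $$\{C(\lambda),D(\mu)\}_1=\tfrac{\eta\lambda}{\lambda-\mu}\bigl(C(\lambda)D(\mu)-C(\mu)D(\lambda)\bigr)-\eta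 A(\lambda)\bigl(\tfrac\gamma\alpha D(\mu)-\tfrac\delta\alpha C(\mu)\bigr),$$ $$\{A(\lambda),D(\mu)\}_1=\tfrac{\eta\lambda}{\lambda-\mu}\bigl(C(\lambda)B(\mu)-C(\mu)B(\lambda)\bigr)-\eta A(\lambda)\bigl(\tfrac\gamma\alpha B(\mu)-\tfrac\beta\alpha C(\mu)\bigr),$$ $$\{D(\lambda),D(\mu)\}_1=\tfrac{\eta\gamma}{\alpha}\bigl(D(\lambda)B(\mu)-D(\mu)B(\lambda)\bigr)-\tfrac{\eta\beta}{\alpha}\bigl(D(\lambda)C(\mu)-D(\mu)C(\lambda)\bigr)+\tfrac{\eta\delta}{\alpha}\bigl(B(\lambda)C(\mu)-B(\mu)C(\lambda)\bigr).$$ -/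

import Mathlib

open Polynomial
open scoped Matrix Kronecker

noncomputable section

namespace SklyaninFamily

/-! ### Bivectors, Poisson brackets, compatibility on `ℂ^ι` -/

section Poisson

variable {ι : Type} [Fintype ι] [DecidableEq ι]

/-- The partial derivative `∂f/∂z_a`. -/
def pderiv (a : ι) (f : (ι → ℂ) → ℂ) (z : ι → ℂ) : ℂ :=
  fderiv ℂ f z (Pi.single a 1)

/-- The bracket `{f, g} = ∑ P^{ab} ∂_a f ∂_b g` associated with a bivector field `P`. -/
def bracket (P : (ι → ℂ) → Matrix ι ι ℂ) (f g : (ι → ℂ) → ℂ) : (ι → ℂ) → ℂ :=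
  fun z => ∑ a, ∑ b, P z a b * pderiv a f z * pderiv b g z

/-- `br` is a Poisson bracket on the holomorphic functions on `ℂ^ι`: on every open set it is
closed, bilinear and skew-symmetric, is a derivation in each argument, and satisfies the
Jacobi identity. -/
structure IsPoissonBracket
    (br : ((ι → ℂ) → ℂ) → ((ι → ℂ) → ℂ) → ((ι → ℂ) → ℂ)) : Prop where
  analytic : ∀ V : Set (ι → ℂ), IsOpen V → ∀ f g : (ι → ℂ) → ℂ,
    AnalyticOnNhd ℂ f V → AnalyticOnNhd ℂ g V → AnalyticOnNhd ℂ (br f g) V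
  linear : ∀ V : Set (ι → ℂ), IsOpen V → ∀ f g h : (ι → ℂ) → ℂ,
    AnalyticOnNhd ℂ f V → AnalyticOnNhd ℂ g V → AnalyticOnNhd ℂ h V →
    ∀ a b : ℂ, ∀ z ∈ V, br (a • f + b • g) h z = a * br f h z + b * br g h z
  skew : ∀ V : Set (ι → ℂ), IsOpen V → ∀ f g : (ι → ℂ) → ℂ,
    AnalyticOnNhd ℂ f V → AnalyticOnNhd ℂ g V →
    ∀ z ∈ V, br f g z = - br g f z
  leibniz : ∀ V : Set (ι → ℂ), IsOpen V → ∀ f g h : (ι → ℂ) → ℂ,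
    AnalyticOnNhd ℂ f V → AnalyticOnNhd ℂ g V → AnalyticOnNhd ℂ h V →
    ∀ z ∈ V, br (f * g) h z = f z * br g h z + br f h z * g z
  jacobi : ∀ V : Set (ι → ℂ), IsOpen V → ∀ f g h : (ι → ℂ) → ℂ,
    AnalyticOnNhd ℂ f V → AnalyticOnNhd ℂ g V → AnalyticOnNhd ℂ h V →
    ∀ z ∈ V, br f (br g h) z + br g (br h f) z + br h (br f g) z = 0

/-- Two brackets are compatible if every linear combination of them is a Poisson bracket. -/
def Compatible (br₁ br₂ : ((ι → ℂ) → ℂ) → ((ι → ℂ) → ℂ) → ((ι → ℂ) → ℂ)) : Prop :=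
  ∀ a b : ℂ, IsPoissonBracket (fun f g => a • br₁ f g + b • br₂ f g)

/-- The summand of the Schouten bracket before the cyclic sum. -/
def schoutenTerm (X Y : (ι → ℂ) → Matrix ι ι ℂ) (z : ι → ℂ) (i j k : ι) : ℂ :=
  ∑ m, (X z m k * pderiv m (fun w => Y w i j) z + Y z m k * pderiv m (fun w => X w i j) z)

/-- The component `[[X, Y]]^{ijk}` of the Schouten bracket of two bivector fields. -/
def schouten (X Y : (ι → ℂ) → Matrix ι ι ℂ) (z : ι → ℂ) (i j k : ι) : ℂ :=
  -(schoutenTerm X Y z i j k + schoutenTerm X Y z j k i + schoutenTerm X Y z k i j)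

end Poisson

/-! ### The tensors `P_k`

A point of the phase space `ℂ^{2n}` is `z : Fin n ⊕ Fin n → ℂ`, with `λ_i = z (Sum.inl i)` and
`μ_i = z (Sum.inr i)`. -/

/-- The canonical Poisson tensor. -/
def tensorZero (n : ℕ) (_z : Fin n ⊕ Fin n → ℂ) : Matrix (Fin n ⊕ Fin n) (Fin n ⊕ Fin n) ℂ :=
  Matrix.fromBlocks 0 1 (-1) 0

/-- The second Poisson tensor, for which `{λ_i, μ_j} = λ_i δ_ij`. -/
def tensorOne (n : ℕ) (z : Fin n ⊕ Fin n → ℂ) : Matrix (Fin n ⊕ Fin n) (Fin n ⊕ Fin n) ℂ :=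
  Matrix.fromBlocks 0 (Matrix.diagonal fun i => z (Sum.inl i))
    (-Matrix.diagonal fun i => z (Sum.inl i)) 0

/-- The recursion operator `N = P_1 P_0⁻¹`. -/
def recursionOp (n : ℕ) (z : Fin n ⊕ Fin n → ℂ) : Matrix (Fin n ⊕ Fin n) (Fin n ⊕ Fin n) ℂ :=
  tensorOne n z * (tensorZero n z)⁻¹

/-- The tensor `P_k = N^k P_0`. -/
def poissonTensor (n k : ℕ) (z : Fin n ⊕ Fin n → ℂ) :
    Matrix (Fin n ⊕ Fin n) (Fin n ⊕ Fin n) ℂ :=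
  recursionOp n z ^ k * tensorZero n z

/-- The bracket `{·,·}_k`. -/
def kBracket (n k : ℕ) : ((Fin n ⊕ Fin n → ℂ) → ℂ) → ((Fin n ⊕ Fin n → ℂ) → ℂ) →
    ((Fin n ⊕ Fin n → ℂ) → ℂ) :=
  bracket (poissonTensor n k)

/-! ### The matrix `T(λ)` in Darboux-Nijenhuis coordinates -/

/-- The domain of the coordinates: the points where `λ_1, …, λ_n` are pairwise distinct. -/
def domain (n : ℕ) : Set (Fin n ⊕ Fin n → ℂ) :=
  {z | Function.Injective fun i : Fin n => z (Sum.inl i)}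

/-- `A(λ) = α (λ - λ_1) ⋯ (λ - λ_n)`. -/
def polyA {n : ℕ} (α : ℂ) (z : Fin n ⊕ Fin n → ℂ) : ℂ[X] :=
  C α * ∏ i, (X - C (z (Sum.inl i)))

/-- `A(λ) / ((λ - λ_i) A'(λ_i))`. -/
def basisPoly {n : ℕ} (α : ℂ) (z : Fin n ⊕ Fin n → ℂ) (i : Fin n) : ℂ[X] :=
  C (α / (derivative (polyA α z)).eval (z (Sum.inl i))) *
    ∏ j ∈ Finset.univ.erase i, (X - C (z (Sum.inl j)))

/-- `B(λ)`, the polynomial with leading coefficient `β` and `B(λ_i) = exp (-η μ_i)`. -/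
def polyB {n : ℕ} (α β η : ℂ) (z : Fin n ⊕ Fin n → ℂ) : ℂ[X] :=
  C (β / α) * polyA α z + ∑ i, C (Complex.exp (-(η * z (Sum.inr i)))) * basisPoly α z i

/-- `C(λ)`, the polynomial with leading coefficient `γ` and `C(λ_i) = -d(λ_i) exp (η μ_i)`. -/
def polyC {n : ℕ} (α γ η : ℂ) (d : ℂ[X]) (z : Fin n ⊕ Fin n → ℂ) : ℂ[X] :=
  C (γ / α) * polyA α z -
    ∑ i, C (d.eval (z (Sum.inl i)) * Complex.exp (η * z (Sum.inr i))) * basisPoly α z i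

/-- `D(λ) = (d(λ) + B(λ) C(λ)) / A(λ)`; the division is exact on `domain n`. -/
def polyD {n : ℕ} (α β γ η : ℂ) (d : ℂ[X]) (z : Fin n ⊕ Fin n → ℂ) : ℂ[X] :=
  (d + polyB α β η z * polyC α γ η d z) / polyA α z

/-- The matrix `T(λ)`. -/
def matT {n : ℕ} (α β γ η : ℂ) (d : ℂ[X]) (z : Fin n ⊕ Fin n → ℂ) :
    Matrix (Fin 2) (Fin 2) ℂ[X] :=
  !![polyA α z, polyB α β η z; polyC α γ η d z, polyD α β γ η d z]

/-! ### The dynamical `r`- and `s`-matrices, for any `2 × 2` polynomial matrix `T` -/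

/-- The value `T(x)` of a polynomial matrix. -/
def evalAt (T : Matrix (Fin 2) (Fin 2) ℂ[X]) (x : ℂ) : Matrix (Fin 2) (Fin 2) ℂ :=
  T.map (Polynomial.eval x)

/-- An operator on `ℂ² ⊗ ℂ²` from its matrix in the ordered basis
`e₁⊗e₁, e₂⊗e₁, e₁⊗e₂, e₂⊗e₂`. -/
def ofArray (M : Matrix (Fin 4) (Fin 4) ℂ) : Matrix (Fin 2 × Fin 2) (Fin 2 × Fin 2) ℂ :=
  Matrix.of fun p q => M (finProdFinEquiv (p.2, p.1)) (finProdFinEquiv (q.2, q.1))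

/-- The permutation operator `Π` of `ℂ² ⊗ ℂ²`. -/
def permOp : Matrix (Fin 2 × Fin 2) (Fin 2 × Fin 2) ℂ :=
  ofArray !![1, 0, 0, 0; 0, 0, 1, 0; 0, 1, 0, 0; 0, 0, 0, 1]

/-- `ρ_Y^{[k]}(x, y)`: the difference of the values at `x` and `y` of the polynomial
(Euclidean) quotient of `λ^k Y(λ)` by `A(λ)`. -/
def rho (k : ℕ) (A Y : ℂ[X]) (x y : ℂ) : ℂ :=
  ((X ^ k * Y) / A).eval x - ((X ^ k * Y) / A).eval y

/-- `r₁₂^{[k]}(x, y)`. -/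
def r12 (η : ℂ) (k : ℕ) (T : Matrix (Fin 2) (Fin 2) ℂ[X]) (x y : ℂ) :
    Matrix (Fin 2 × Fin 2) (Fin 2 × Fin 2) ℂ :=
  (η / (x - y)) • ofArray
    !![1, 0, 0, 0;
       0, 1 - (x ^ k + y ^ k) / 2, y ^ k, 0;
       0, x ^ k, 1 - (x ^ k + y ^ k) / 2, 0;
       0, rho k (T 0 0) (T 1 0) x y, -rho k (T 0 0) (T 1 0) x y, 1]

/-- `r₂₁^{[k]}(x, y)`. -/
def r21 (η : ℂ) (k : ℕ) (T : Matrix (Fin 2) (Fin 2) ℂ[X]) (x y : ℂ) :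
    Matrix (Fin 2 × Fin 2) (Fin 2 × Fin 2) ℂ :=
  (η / (x - y)) • ofArray
    !![1, 0, 0, 0;
       0, 1 - (x ^ k + y ^ k) / 2, x ^ k, rho k (T 0 0) (T 0 1) x y;
       0, y ^ k, 1 - (x ^ k + y ^ k) / 2, -rho k (T 0 0) (T 0 1) x y;
       0, 0, 0, 1]

/-- `s₁₂^{[k]}(x, y)`. -/
def s12 (η : ℂ) (k : ℕ) (T : Matrix (Fin 2) (Fin 2) ℂ[X]) (x y : ℂ) :
    Matrix (Fin 2 × Fin 2) (Fin 2 × Fin 2) ℂ :=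
  (η / (x - y)) • ofArray
    !![0, -rho k (T 0 0) (T 0 1) x y, 0, 0;
       0, (x ^ k - y ^ k) / 2, 0, 0;
       -rho k (T 0 0) (T 1 0) x y, -rho k (T 0 0) (T 1 1) x y, (x ^ k - y ^ k) / 2, 0;
       0, 0, 0, 0]

/-- `s₂₁^{[k]} = Π s₁₂^{[k]} Π`. -/
def s21 (η : ℂ) (k : ℕ) (T : Matrix (Fin 2) (Fin 2) ℂ[X]) (x y : ℂ) :
    Matrix (Fin 2 × Fin 2) (Fin 2 × Fin 2) ℂ :=
  permOp * s12 η k T x y * permOp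

/-- `T₁(x) = T(x) ⊗ I`. -/
def leg1 (T : Matrix (Fin 2) (Fin 2) ℂ[X]) (x : ℂ) :
    Matrix (Fin 2 × Fin 2) (Fin 2 × Fin 2) ℂ :=
  evalAt T x ⊗ₖ (1 : Matrix (Fin 2) (Fin 2) ℂ)

/-- `T₂(y) = I ⊗ T(y)`. -/
def leg2 (T : Matrix (Fin 2) (Fin 2) ℂ[X]) (y : ℂ) :
    Matrix (Fin 2 × Fin 2) (Fin 2 × Fin 2) ℂ :=
  (1 : Matrix (Fin 2) (Fin 2) ℂ) ⊗ₖ evalAt T y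

/-- `r₁₂ T₁(x) T₂(y) - T₁(x) T₂(y) r₂₁ + T₁(x) s₁₂ T₂(y) - T₂(y) s₂₁ T₁(x)`. -/
def rsForm (η : ℂ) (k : ℕ) (T : Matrix (Fin 2) (Fin 2) ℂ[X]) (x y : ℂ) :
    Matrix (Fin 2 × Fin 2) (Fin 2 × Fin 2) ℂ :=
  r12 η k T x y * leg1 T x * leg2 T y - leg1 T x * leg2 T y * r21 η k T x y
    + leg1 T x * s12 η k T x y * leg2 T y - leg2 T y * s21 η k T x y * leg1 T x

/-- The Sklyanin form `[r(x - y), T₁(x) T₂(y)]` with `r(x - y) = η/(x - y) Π`. -/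
def sklyaninForm (η : ℂ) (T : Matrix (Fin 2) (Fin 2) ℂ[X]) (x y : ℂ) :
    Matrix (Fin 2 × Fin 2) (Fin 2 × Fin 2) ℂ :=
  ((η / (x - y)) • permOp) * (leg1 T x * leg2 T y)
    - (leg1 T x * leg2 T y) * ((η / (x - y)) • permOp)

/-- The matrix `{T₁(x), T₂(y)}`, whose `((i,j),(k,l))` entry is `{T_ik(x), T_jl(y)}`, at the
point `z`, for a matrix `T` depending on the point. -/
def bracketMatrix {n : ℕ}
    (br : ((Fin n ⊕ Fin n → ℂ) → ℂ) → ((Fin n ⊕ Fin n → ℂ) → ℂ) → ((Fin n ⊕ Fin n → ℂ) → ℂ))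
    (T : (Fin n ⊕ Fin n → ℂ) → Matrix (Fin 2) (Fin 2) ℂ[X]) (x y : ℂ)
    (z : Fin n ⊕ Fin n → ℂ) : Matrix (Fin 2 × Fin 2) (Fin 2 × Fin 2) ℂ :=
  Matrix.of fun p q =>
    br (fun w => (T w p.1 q.1).eval x) (fun w => (T w p.2 q.2).eval y) z

/-- The bracket relations of the first nontrivial bracket of the family. Entries of `T` are
given by their positions, `(0,0), (0,1), (1,0), (1,1)` for `A, B, C, D`, and `F a b x y` is the
bracket `{a(x), b(y)}`. -/
structure FirstBracketTable (η α β γ δ : ℂ) (A B C D : ℂ → ℂ)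
    (F : Fin 2 × Fin 2 → Fin 2 × Fin 2 → ℂ → ℂ → ℂ) : Prop where
  skew : ∀ a b x y, x ≠ y → F a b x y = -F b a y x
  AA : ∀ x y, x ≠ y → F (0, 0) (0, 0) x y = 0
  BB : ∀ x y, x ≠ y → F (0, 1) (0, 1) x y = 0
  CC : ∀ x y, x ≠ y → F (1, 0) (1, 0) x y = 0
  BA : ∀ x y, x ≠ y → F (0, 1) (0, 0) x y =
    η / (x - y) * (x * B x * A y - y * B y * A x) - η * β / α * A x * A y
  CA : ∀ x y, x ≠ y → F (1, 0) (0, 0) x y =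
    -η / (x - y) * (x * C x * A y - y * C y * A x) + η * γ / α * A x * A y
  BC : ∀ x y, x ≠ y → F (0, 1) (1, 0) x y =
    η / (x - y) * (x * D x * A y - y * D y * A x) - η * δ / α * A x * A y
  BD : ∀ x y, x ≠ y → F (0, 1) (1, 1) x y =
    -(η * x) / (x - y) * (B x * D y - B y * D x) + η * A x * (β / α * D y - δ / α * B y)
  CD : ∀ x y, x ≠ y → F (1, 0) (1, 1) x y =
    η * x / (x - y) * (C x * D y - C y * D x) - η * A x * (γ / α * D y - δ / α * C y)
  AD : ∀ x y, x ≠ y → F (0, 0) (1, 1) x y =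
    η * x / (x - y) * (C x * B y - C y * B x) - η * A x * (γ / α * B y - β / α * C y)
  DD : ∀ x y, x ≠ y → F (1, 1) (1, 1) x y =
    η * γ / α * (D x * B y - D y * B x) - η * β / α * (D x * C y - D y * C x)
      + η * δ / α * (B x * C y - B y * C x)

/-- The matrices `M x y` are the `{T₁(x), T₂(y)}` of the first nontrivial bracket of the family,
for a polynomial matrix `T` whose entries have degree at most `n`. -/
def IsFirstBracket (η : ℂ) (n : ℕ) (T : Matrix (Fin 2) (Fin 2) ℂ[X])
    (M : ℂ → ℂ → Matrix (Fin 2 × Fin 2) (Fin 2 × Fin 2) ℂ) : Prop :=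
  FirstBracketTable η ((T 0 0).coeff n) ((T 0 1).coeff n) ((T 1 0).coeff n) ((T 1 1).coeff n)
    (fun x => (T 0 0).eval x) (fun x => (T 0 1).eval x)
    (fun x => (T 1 0).eval x) (fun x => (T 1 1).eval x)
    (fun a b x y => M x y (a.1, b.1) (a.2, b.2))

end SklyaninFamily

end

/-! Every bracket of the family has the form `{λ_i, μ_j} = φ(λ_i) δ_ij` with `φ` a polynomial, and
this class is closed under linear combinations. The Poisson property and compatibility therefore
both reduce to the Jacobi identity for a single arbitrary `φ` (`diagBracket_jacobi`).

For the matrix bracket, let `L_i` be the Lagrange basis polynomials at the roots of `A`. Since `A`,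
`B`, `C` have constant leading coefficients, their partial derivatives have degree below `n` and are
the Lagrange interpolants of their node values. These follow from the known values of `A`, `B`, `C`
at `λ_i` (`pderiv_eval_eq_sum_nodes`). Up to a factor `±η`, the brackets `{A,B}`, `{A,C}`, `{B,C}`
become the sums `∑ λ_i^k Y(λ_i) A'(λ_i) L_i(x) L_i(y)` with `Y = B, C, D`. Multiplied by `y - x`,
such a sum splits into interpolants of `λ^k Y`, that is, remainders modulo `A`; the discarded
quotients are the source of the `ρ` terms (`mul_nodeKernel`).

The entry `D` is never differentiated explicitly. Since `A D = d + B C` and `d` is constant on phase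
space, the derivation property expresses `A(x) {D(x), ·}` through the brackets of `A`, `B`, `C`. The
result is divisible by `A(x)`, and the factor is cancelled in `ℂ[X]` (`EntryBrackets`).

The statements about arbitrary `T` are algebra: the right-hand side is expanded once into a table of
entries (`rsForm_eq`), and for `k = 0, 1` the Euclidean quotients have degree at most `k`, which
makes `ρ` explicit. -/

namespace SklyaninFamily

set_option linter.unusedSectionVars false

/-! ### Calculus of partial derivatives. -/

section PartialDerivatives

variable {ι : Type} [Fintype ι] [DecidableEq ι] {a b : ι} {f g : (ι → ℂ) → ℂ} {z : ι → ℂ}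

theorem pderiv_congr (h : f =ᶠ[nhds z] g) : pderiv a f z = pderiv a g z := by
  simp only [pderiv, h.fderiv_eq]

theorem pderiv_add (hf : DifferentiableAt ℂ f z) (hg : DifferentiableAt ℂ g z) :
    pderiv a (fun w => f w + g w) z = pderiv a f z + pderiv a g z := by
  simp only [pderiv]
  rw [fderiv_fun_add hf hg]; simp

theorem pderiv_sub (hf : DifferentiableAt ℂ f z) (hg : DifferentiableAt ℂ g z) :
    pderiv a (fun w => f w - g w) z = pderiv a f z - pderiv a g z := by
  simp only [pderiv]
  rw [fderiv_fun_sub hf hg]; simp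

theorem pderiv_mul (hf : DifferentiableAt ℂ f z) (hg : DifferentiableAt ℂ g z) :
    pderiv a (fun w => f w * g w) z = f z * pderiv a g z + pderiv a f z * g z := by
  simp only [pderiv]
  rw [fderiv_fun_mul hf hg]; simp [mul_comm]

theorem pderiv_sum {κ : Type} {s : Finset κ} {F : κ → (ι → ℂ) → ℂ}
    (hF : ∀ i ∈ s, DifferentiableAt ℂ (F i) z) :
    pderiv a (fun w => ∑ i ∈ s, F i w) z = ∑ i ∈ s, pderiv a (F i) z := by
  simp only [pderiv]
  rw [fderiv_fun_sum hF]; simp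

@[simp]
theorem pderiv_const (c : ℂ) : pderiv a (fun _ => c) z = 0 := by
  simp [pderiv]

theorem pderiv_comp_coord {h : ℂ → ℂ} {h' : ℂ} (hh : HasDerivAt h h' (z b)) :
    pderiv a (fun w => h (w b)) z = if a = b then h' else 0 := by
  have hp : HasFDerivAt (fun w : ι → ℂ => w b) (ContinuousLinearMap.proj (R := ℂ) b) z :=
    (ContinuousLinearMap.proj (R := ℂ) (φ := fun _ : ι => ℂ) b).hasFDerivAt
  have := hh.comp_hasFDerivAt z hp
  simp only [pderiv]
  rw [show (fun w : ι → ℂ => h (w b)) = h ∘ (fun w => w b) from rfl, this.fderiv]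
  simp [Pi.single_apply, eq_comm]

theorem pderiv_coord : pderiv a (fun w => w b) z = if a = b then 1 else 0 :=
  pderiv_comp_coord (hasDerivAt_id (z b))

theorem pderiv_eval_coord (φ : ℂ[X]) :
    pderiv a (fun w => φ.eval (w b)) z = if a = b then (derivative φ).eval (z b) else 0 :=
  pderiv_comp_coord (φ.hasDerivAt (z b))

theorem analyticOnNhd_coord (b : ι) (V : Set (ι → ℂ)) : AnalyticOnNhd ℂ (fun w => w b) V :=
  (ContinuousLinearMap.proj (R := ℂ) (φ := fun _ : ι => ℂ) b).analyticOnNhd V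

theorem analyticOnNhd_eval_coord (φ : ℂ[X]) (b : ι) (V : Set (ι → ℂ)) :
    AnalyticOnNhd ℂ (fun w => φ.eval (w b)) V :=
  fun z _ => by
    simp only [eval_eq_sum_range]
    exact Finset.analyticAt_fun_sum _ fun i _ =>
      analyticAt_const.mul ((analyticOnNhd_coord b Set.univ z trivial).pow i)

theorem analyticOnNhd_pderiv {V : Set (ι → ℂ)} (hf : AnalyticOnNhd ℂ f V) (a : ι) :
    AnalyticOnNhd ℂ (pderiv a f) V :=
  fun z hz =>
    ((ContinuousLinearMap.apply ℂ ℂ (Pi.single a (1 : ℂ) : ι → ℂ)).analyticAt _).comp (hf z hz).fderiv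

theorem pderiv_comm (hf : AnalyticAt ℂ f z) (a b : ι) :
    pderiv a (pderiv b f) z = pderiv b (pderiv a f) z := by
  have hs : IsSymmSndFDerivAt ℂ f z := hf.contDiffAt.isSymmSndFDerivAt_of_omega
  have key : ∀ a b : ι, pderiv a (pderiv b f) z =
      fderiv ℂ (fderiv ℂ f) z (Pi.single a 1) (Pi.single b 1) := by
    intro a b
    have : pderiv b f = fun w => fderiv ℂ f w (Pi.single b 1) := rfl
    rw [this, pderiv, fderiv_clm_apply hf.fderiv.differentiableAt (differentiableAt_const _)]
    simp
  rw [key, key, hs.eq]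

end PartialDerivatives

/-! ### Poisson property and compatibility. -/

section DiagonalBrackets

variable {n : ℕ}

/-- The bracket with `{λ_i, μ_j} = φ(λ_i) δ_ij`. -/
noncomputable def diagBracket (φ : ℂ[X]) (f g : (Fin n ⊕ Fin n → ℂ) → ℂ) :
    (Fin n ⊕ Fin n → ℂ) → ℂ :=
  fun z => ∑ i, φ.eval (z (Sum.inl i)) *
    (pderiv (Sum.inl i) f z * pderiv (Sum.inr i) g z
      - pderiv (Sum.inr i) f z * pderiv (Sum.inl i) g z)

/-- The recursion operator is block diagonal with both blocks `Λ`, so its powers are computed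
entrywise. -/
theorem poissonTensor_eq (k : ℕ) (z : Fin n ⊕ Fin n → ℂ) :
    poissonTensor n k z = Matrix.fromBlocks 0 (Matrix.diagonal fun i => z (Sum.inl i) ^ k)
      (-Matrix.diagonal fun i => z (Sum.inl i) ^ k) 0 := by
  have hinv : (tensorZero n z)⁻¹ = Matrix.fromBlocks 0 (-1) 1 0 := by
    apply Matrix.inv_eq_right_inv
    simp [tensorZero, Matrix.fromBlocks_multiply]
  have hN : recursionOp n z = Matrix.fromBlocks (Matrix.diagonal fun i => z (Sum.inl i)) 0 0
      (Matrix.diagonal fun i => z (Sum.inl i)) := by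
    simp [recursionOp, hinv, tensorOne, Matrix.fromBlocks_multiply]
  rw [poissonTensor, hN, Matrix.fromBlocks_diagonal_pow, Matrix.diagonal_pow, tensorZero,
    Matrix.fromBlocks_multiply]
  simp [Pi.pow_def]

theorem kBracket_eq (k : ℕ) : kBracket n k = diagBracket (X ^ k) := by
  funext f g z
  simp only [kBracket, bracket, diagBracket, poissonTensor_eq, Fintype.sum_sum_type,
    Matrix.fromBlocks_apply₁₁, Matrix.fromBlocks_apply₁₂, Matrix.fromBlocks_apply₂₁,
    Matrix.fromBlocks_apply₂₂, Matrix.zero_apply, Matrix.neg_apply, Matrix.diagonal_apply]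
  simp only [zero_mul, Finset.sum_const_zero, zero_add, add_zero, neg_mul, ite_mul,
    Finset.sum_neg_distrib, Finset.sum_ite_eq, Finset.mem_univ, if_true, eval_pow, eval_X]
  rw [← sub_eq_add_neg, ← Finset.sum_sub_distrib]
  exact Finset.sum_congr rfl fun i _ => by ring

/-- Compatibility follows from this closure property: a pencil of two such brackets is again such a
bracket, with another `φ`. -/
theorem diagBracket_combination (φ ψ : ℂ[X]) (a b : ℂ) (f g : (Fin n ⊕ Fin n → ℂ) → ℂ) :
    a • diagBracket φ f g + b • diagBracket ψ f g = diagBracket (C a * φ + C b * ψ) f g := by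
  funext z
  simp only [diagBracket, Pi.add_apply, Pi.smul_apply, smul_eq_mul, Finset.mul_sum,
    ← Finset.sum_add_distrib, eval_add, eval_mul, eval_C]
  exact Finset.sum_congr rfl fun i _ => by ring

theorem analyticOnNhd_diagBracket (φ : ℂ[X]) {V : Set (Fin n ⊕ Fin n → ℂ)}
    {f g : (Fin n ⊕ Fin n → ℂ) → ℂ} (hf : AnalyticOnNhd ℂ f V) (hg : AnalyticOnNhd ℂ g V) :
    AnalyticOnNhd ℂ (diagBracket φ f g) V := fun z hz =>
  Finset.analyticAt_fun_sum _ fun _ _ => (analyticOnNhd_eval_coord φ _ V z hz).mul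
    (((analyticOnNhd_pderiv hf _ z hz).mul (analyticOnNhd_pderiv hg _ z hz)).sub
      ((analyticOnNhd_pderiv hf _ z hz).mul (analyticOnNhd_pderiv hg _ z hz)))

theorem diagBracket_skew (φ : ℂ[X]) (f g : (Fin n ⊕ Fin n → ℂ) → ℂ) (z : Fin n ⊕ Fin n → ℂ) :
    diagBracket φ f g z = -diagBracket φ g f z := by
  simp only [diagBracket, ← Finset.sum_neg_distrib]
  exact Finset.sum_congr rfl fun i _ => by ring

theorem diagBracket_mul_left (φ : ℂ[X]) {f g h : (Fin n ⊕ Fin n → ℂ) → ℂ}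
    {z : Fin n ⊕ Fin n → ℂ} (hf : DifferentiableAt ℂ f z) (hg : DifferentiableAt ℂ g z) :
    diagBracket φ (fun w => f w * g w) h z =
      f z * diagBracket φ g h z + diagBracket φ f h z * g z := by
  simp only [diagBracket, Finset.mul_sum, Finset.sum_mul, ← Finset.sum_add_distrib,
    pderiv_mul hf hg]
  exact Finset.sum_congr rfl fun i _ => by ring

theorem diagBracket_add_left (φ : ℂ[X]) {f g h : (Fin n ⊕ Fin n → ℂ) → ℂ}
    {z : Fin n ⊕ Fin n → ℂ} (hf : DifferentiableAt ℂ f z) (hg : DifferentiableAt ℂ g z) :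
    diagBracket φ (fun w => f w + g w) h z = diagBracket φ f h z + diagBracket φ g h z := by
  simp only [diagBracket, ← Finset.sum_add_distrib, pderiv_add hf hg]
  exact Finset.sum_congr rfl fun i _ => by ring

theorem diagBracket_const_left (φ : ℂ[X]) (c : ℂ) (h : (Fin n ⊕ Fin n → ℂ) → ℂ)
    (z : Fin n ⊕ Fin n → ℂ) : diagBracket φ (fun _ => c) h z = 0 := by
  simp [diagBracket]

theorem diagBracket_congr_left (φ : ℂ[X]) {f g : (Fin n ⊕ Fin n → ℂ) → ℂ}
    {z : Fin n ⊕ Fin n → ℂ} (hfg : f =ᶠ[nhds z] g) (h : (Fin n ⊕ Fin n → ℂ) → ℂ) :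
    diagBracket φ f h z = diagBracket φ g h z := by
  simp only [diagBracket, pderiv_congr hfg]

/-- The contribution of the pair `(i, j)` of conjugate coordinates to `{f, {g, h}}`. -/
noncomputable def nestedTerm (φ : ℂ[X]) (z : Fin n ⊕ Fin n → ℂ) (i j : Fin n)
    (f g h : (Fin n ⊕ Fin n → ℂ) → ℂ) : ℂ :=
  φ.eval (z (Sum.inl i)) *
    (pderiv (Sum.inl i) f z * (φ.eval (z (Sum.inl j)) *
      ((pderiv (Sum.inl j) g z * pderiv (Sum.inr i) (pderiv (Sum.inr j) h) z
        + pderiv (Sum.inr i) (pderiv (Sum.inl j) g) z * pderiv (Sum.inr j) h z)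
      - (pderiv (Sum.inr j) g z * pderiv (Sum.inr i) (pderiv (Sum.inl j) h) z
        + pderiv (Sum.inr i) (pderiv (Sum.inr j) g) z * pderiv (Sum.inl j) h z)))
    - pderiv (Sum.inr i) f z * (φ.eval (z (Sum.inl j)) *
      ((pderiv (Sum.inl j) g z * pderiv (Sum.inl i) (pderiv (Sum.inr j) h) z
        + pderiv (Sum.inl i) (pderiv (Sum.inl j) g) z * pderiv (Sum.inr j) h z)
      - (pderiv (Sum.inr j) g z * pderiv (Sum.inl i) (pderiv (Sum.inl j) h) z
        + pderiv (Sum.inl i) (pderiv (Sum.inr j) g) z * pderiv (Sum.inl j) h z))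
      + (if i = j then (derivative φ).eval (z (Sum.inl j)) else 0) *
        (pderiv (Sum.inl j) g z * pderiv (Sum.inr j) h z
          - pderiv (Sum.inr j) g z * pderiv (Sum.inl j) h z)))

/-- The last summand comes from differentiating the coefficient `φ(λ_j)`; it is the only departure
from the canonical bracket. -/
theorem pderiv_diagBracket (φ : ℂ[X]) {V : Set (Fin n ⊕ Fin n → ℂ)}
    {g h : (Fin n ⊕ Fin n → ℂ) → ℂ} (hg : AnalyticOnNhd ℂ g V) (hh : AnalyticOnNhd ℂ h V)
    {z : Fin n ⊕ Fin n → ℂ} (hz : z ∈ V) (a : Fin n ⊕ Fin n) :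
    pderiv a (diagBracket φ g h) z = ∑ j, (φ.eval (z (Sum.inl j)) *
      ((pderiv (Sum.inl j) g z * pderiv a (pderiv (Sum.inr j) h) z
        + pderiv a (pderiv (Sum.inl j) g) z * pderiv (Sum.inr j) h z)
      - (pderiv (Sum.inr j) g z * pderiv a (pderiv (Sum.inl j) h) z
        + pderiv a (pderiv (Sum.inr j) g) z * pderiv (Sum.inl j) h z))
      + (if a = Sum.inl j then (derivative φ).eval (z (Sum.inl j)) else 0) *
        (pderiv (Sum.inl j) g z * pderiv (Sum.inr j) h z
          - pderiv (Sum.inr j) g z * pderiv (Sum.inl j) h z)) := by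
  have Dg : ∀ b, DifferentiableAt ℂ (pderiv b g) z :=
    fun b => (analyticOnNhd_pderiv hg b z hz).differentiableAt
  have Dh : ∀ b, DifferentiableAt ℂ (pderiv b h) z :=
    fun b => (analyticOnNhd_pderiv hh b z hz).differentiableAt
  have Dφ : ∀ b, DifferentiableAt ℂ (fun w : Fin n ⊕ Fin n → ℂ => φ.eval (w b)) z :=
    fun b => (analyticOnNhd_eval_coord φ b V z hz).differentiableAt
  unfold diagBracket
  rw [pderiv_sum (fun j _ => (Dφ (Sum.inl j)).fun_mul
    (((Dg (Sum.inl j)).fun_mul (Dh (Sum.inr j))).fun_sub ((Dg (Sum.inr j)).fun_mul (Dh (Sum.inl j)))))]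
  refine Finset.sum_congr rfl fun j _ => ?_
  rw [pderiv_mul (Dφ _) (((Dg _).fun_mul (Dh _)).fun_sub ((Dg _).fun_mul (Dh _))),
    pderiv_sub ((Dg _).fun_mul (Dh _)) ((Dg _).fun_mul (Dh _)), pderiv_mul (Dg _) (Dh _),
    pderiv_mul (Dg _) (Dh _), pderiv_eval_coord]

theorem diagBracket_diagBracket (φ : ℂ[X]) {V : Set (Fin n ⊕ Fin n → ℂ)}
    (f : (Fin n ⊕ Fin n → ℂ) → ℂ)
    {g h : (Fin n ⊕ Fin n → ℂ) → ℂ} (hg : AnalyticOnNhd ℂ g V) (hh : AnalyticOnNhd ℂ h V)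
    {z : Fin n ⊕ Fin n → ℂ} (hz : z ∈ V) :
    diagBracket φ f (diagBracket φ g h) z = ∑ i, ∑ j, nestedTerm φ z i j f g h := by
  rw [diagBracket]
  refine Finset.sum_congr rfl fun i _ => ?_
  rw [pderiv_diagBracket φ hg hh hz, pderiv_diagBracket φ hg hh hz, Finset.mul_sum,
    Finset.mul_sum, ← Finset.sum_sub_distrib, Finset.mul_sum]
  refine Finset.sum_congr rfl fun j _ => ?_
  simp only [nestedTerm, Sum.inl.injEq, reduceCtorEq, if_false]
  ring

theorem sum_sum_eq_zero_of_antisymm {κ : Type} [Fintype κ] {S : κ → κ → ℂ}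
    (hS : ∀ i j, S i j + S j i = 0) : ∑ i, ∑ j, S i j = 0 := by
  have h : (∑ i, ∑ j, S i j) + ∑ i, ∑ j, S i j = 0 := by
    nth_rewrite 2 [Finset.sum_comm]
    simp [← Finset.sum_add_distrib, hS]
  simpa using h

/-- The terms with second derivatives cancel between the pairs `(i, j)` and `(j, i)`, as for the
canonical bracket. The terms with `φ'` occur only for `i = j`; their cyclic sum is a 3 × 3
determinant in which the column of `μ_i`-derivatives appears twice. -/
theorem diagBracket_jacobi (φ : ℂ[X]) {V : Set (Fin n ⊕ Fin n → ℂ)}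
    {f g h : (Fin n ⊕ Fin n → ℂ) → ℂ} (hf : AnalyticOnNhd ℂ f V) (hg : AnalyticOnNhd ℂ g V)
    (hh : AnalyticOnNhd ℂ h V) {z : Fin n ⊕ Fin n → ℂ} (hz : z ∈ V) :
    diagBracket φ f (diagBracket φ g h) z + diagBracket φ g (diagBracket φ h f) z
      + diagBracket φ h (diagBracket φ f g) z = 0 := by
  rw [diagBracket_diagBracket φ f hg hh hz, diagBracket_diagBracket φ g hh hf hz,
    diagBracket_diagBracket φ h hf hg hz]
  simp only [← Finset.sum_add_distrib]
  refine sum_sum_eq_zero_of_antisymm fun i j => ?_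
  -- Mixed second derivatives are brought to one fixed order, so that `ring` sees equal ones as the
  -- same atom.
  have hl : ∀ {u : (Fin n ⊕ Fin n → ℂ) → ℂ}, AnalyticOnNhd ℂ u V →
      pderiv (Sum.inl j) (pderiv (Sum.inl i) u) z = pderiv (Sum.inl i) (pderiv (Sum.inl j) u) z :=
    fun hu => pderiv_comm (hu z hz) _ _
  have hr : ∀ {u : (Fin n ⊕ Fin n → ℂ) → ℂ}, AnalyticOnNhd ℂ u V →
      pderiv (Sum.inr j) (pderiv (Sum.inr i) u) z = pderiv (Sum.inr i) (pderiv (Sum.inr j) u) z :=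
    fun hu => pderiv_comm (hu z hz) _ _
  have hm : ∀ {u : (Fin n ⊕ Fin n → ℂ) → ℂ}, AnalyticOnNhd ℂ u V → ∀ i j,
      pderiv (Sum.inr j) (pderiv (Sum.inl i) u) z = pderiv (Sum.inl i) (pderiv (Sum.inr j) u) z :=
    fun hu _ _ => pderiv_comm (hu z hz) _ _
  simp only [nestedTerm, hl hf, hl hg, hl hh, hr hf, hr hg, hr hh, hm hf, hm hg, hm hh]
  by_cases hij : i = j
  · subst hij
    simp only [if_true]
    ring
  · simp only [if_neg hij, if_neg (Ne.symm hij)]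
    ring

theorem isPoissonBracket_diagBracket (φ : ℂ[X]) :
    IsPoissonBracket (diagBracket (n := n) φ) where
  analytic _ _ _ _ hf hg := analyticOnNhd_diagBracket φ hf hg
  linear V _ f g h hf hg _ a b z hz := by
    have Df := (hf z hz).differentiableAt
    have Dg := (hg z hz).differentiableAt
    change diagBracket φ (fun w => a * f w + b * g w) h z = _
    rw [diagBracket_add_left φ (Df.const_mul a) (Dg.const_mul b),
      diagBracket_mul_left φ (differentiableAt_const a) Df,
      diagBracket_mul_left φ (differentiableAt_const b) Dg,
      diagBracket_const_left, diagBracket_const_left]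
    ring
  skew _ _ f g _ _ z _ := diagBracket_skew φ f g z
  leibniz _ _ _ _ _ hf hg _ _ hz :=
    diagBracket_mul_left φ (hf _ hz).differentiableAt (hg _ hz).differentiableAt
  jacobi _ _ _ _ _ hf hg hh _ hz := diagBracket_jacobi φ hf hg hh hz

/-- For `k = 0` the truncated exponent `k - 1` is harmless because of the factor `k`. -/
theorem pderiv_poissonTensor (k : ℕ) (m a b : Fin n ⊕ Fin n) (z : Fin n ⊕ Fin n → ℂ) :
    pderiv m (fun w => poissonTensor n k w a b) z =
      match a, b with
      | Sum.inl i, Sum.inr j => if i = j ∧ m = Sum.inl i then k * z (Sum.inl i) ^ (k - 1) else 0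
      | Sum.inr i, Sum.inl j => if i = j ∧ m = Sum.inl i then -(k * z (Sum.inl i) ^ (k - 1)) else 0
      | _, _ => 0 := by
  simp only [poissonTensor_eq]
  rcases a with i | i <;> rcases b with j | j
  · simp
  · by_cases hij : i = j
    · subst hij
      simpa using pderiv_comp_coord (a := m) (hasDerivAt_pow k (z (Sum.inl i)))
    · simp [hij]
  · by_cases hij : i = j
    · subst hij
      simpa using pderiv_comp_coord (a := m) (hasDerivAt_pow k (z (Sum.inl i))).neg
    · simp [hij]
  · simp

/-- A nonzero `∂_m P^{ab}` forces `m = λ_p` with `a, b` conjugate of index `p`, and contraction then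
forces `c = μ_p`. The only candidates are thus the components `λ_p, μ_p, μ_p` in some order, where
two terms of the cyclic sum cancel by skewness. -/
theorem schouten_poissonTensor (k l : ℕ) (z : Fin n ⊕ Fin n → ℂ) (a b c : Fin n ⊕ Fin n) :
    schouten (poissonTensor n k) (poissonTensor n l) z a b c = 0 := by
  simp only [schouten, schoutenTerm, pderiv_poissonTensor]
  simp only [poissonTensor_eq, Fintype.sum_sum_type]
  rcases a with i | i <;> rcases b with j | j <;> rcases c with p | p <;>
    simp [Matrix.diagonal_apply, ite_and, Finset.sum_add_distrib] <;>
    (try grind)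

end DiagonalBrackets

/-! ### Polynomials with holomorphic coefficients. -/

section CoefficientFamilies

variable {ι : Type} [Fintype ι] {V : Set (ι → ℂ)} {P Q : (ι → ℂ) → ℂ[X]}

/-- The coefficients of the polynomial `P z` are holomorphic functions of `z ∈ V`. -/
def CoeffAnalyticOn (V : Set (ι → ℂ)) (P : (ι → ℂ) → ℂ[X]) : Prop :=
  ∀ m, AnalyticOnNhd ℂ (fun z => (P z).coeff m) V

theorem CoeffAnalyticOn.const (p : ℂ[X]) : CoeffAnalyticOn V fun _ => p :=
  fun _ _ _ => analyticAt_const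

theorem CoeffAnalyticOn.monomialZero {f : (ι → ℂ) → ℂ} (hf : AnalyticOnNhd ℂ f V) :
    CoeffAnalyticOn V fun z => C (f z) := fun m => by
  by_cases hm : m = 0
  · simpa [hm] using hf
  · simpa [coeff_C, hm] using (analyticOnNhd_const : AnalyticOnNhd ℂ (fun _ => (0 : ℂ)) V)

theorem CoeffAnalyticOn.add (hP : CoeffAnalyticOn V P) (hQ : CoeffAnalyticOn V Q) :
    CoeffAnalyticOn V fun z => P z + Q z := fun m => by
  simp only [coeff_add]
  exact AnalyticOnNhd.add (hP m) (hQ m)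

theorem CoeffAnalyticOn.sub (hP : CoeffAnalyticOn V P) (hQ : CoeffAnalyticOn V Q) :
    CoeffAnalyticOn V fun z => P z - Q z := fun m => by
  simp only [coeff_sub]
  exact AnalyticOnNhd.sub (hP m) (hQ m)

theorem CoeffAnalyticOn.mul (hP : CoeffAnalyticOn V P) (hQ : CoeffAnalyticOn V Q) :
    CoeffAnalyticOn V fun z => P z * Q z := fun m => by
  simp only [coeff_mul]
  exact Finset.analyticOnNhd_fun_sum _ fun i _ => AnalyticOnNhd.mul (hP _) (hQ _)

theorem CoeffAnalyticOn.sum {κ : Type} {s : Finset κ} {F : κ → (ι → ℂ) → ℂ[X]}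
    (hF : ∀ i ∈ s, CoeffAnalyticOn V (F i)) : CoeffAnalyticOn V fun z => ∑ i ∈ s, F i z :=
  fun m => by
    simp only [finsetSum_coeff]
    exact Finset.analyticOnNhd_fun_sum _ fun i hi => hF i hi m

theorem CoeffAnalyticOn.prod {κ : Type} [DecidableEq κ] {s : Finset κ} {F : κ → (ι → ℂ) → ℂ[X]}
    (hF : ∀ i ∈ s, CoeffAnalyticOn V (F i)) : CoeffAnalyticOn V fun z => ∏ i ∈ s, F i z := by
  induction s using Finset.induction_on with
  | empty => simpa using CoeffAnalyticOn.const (V := V) 1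
  | insert i s his ih =>
    simp only [Finset.prod_insert his]
    exact (hF i (by simp)).mul (ih fun j hj => hF j (by simp [hj]))

theorem CoeffAnalyticOn.derivative (hP : CoeffAnalyticOn V P) :
    CoeffAnalyticOn V fun z => Polynomial.derivative (P z) := fun m => by
  simp only [coeff_derivative]
  exact AnalyticOnNhd.mul (hP _) analyticOnNhd_const

theorem CoeffAnalyticOn.eval (hV : IsOpen V) (hP : CoeffAnalyticOn V P) {N : ℕ}
    (hdeg : ∀ z ∈ V, (P z).natDegree ≤ N) {f : (ι → ℂ) → ℂ} (hf : AnalyticOnNhd ℂ f V) :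
    AnalyticOnNhd ℂ (fun z => (P z).eval (f z)) V := by
  have h : AnalyticOnNhd ℂ (fun z => ∑ m ∈ Finset.range (N + 1), (P z).coeff m * f z ^ m) V :=
    Finset.analyticOnNhd_fun_sum _ fun m _ => AnalyticOnNhd.mul (hP m) (hf.pow m)
  exact h.congr hV fun z hz => (eval_eq_sum_range' (Nat.lt_succ_of_le (hdeg z hz)) _).symm

/-- Exact quotients by a family with constant leading coefficient. -/
theorem CoeffAnalyticOn.of_mul_eq (hV : IsOpen V) {A D E : (ι → ℂ) → ℂ[X]} {n : ℕ} {α : ℂ}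
    (hα : α ≠ 0) (hA : CoeffAnalyticOn V A) (hE : CoeffAnalyticOn V E)
    (hAdeg : ∀ z ∈ V, (A z).natDegree ≤ n) (hAlead : ∀ z ∈ V, (A z).coeff n = α) {N : ℕ}
    (hDdeg : ∀ z ∈ V, (D z).natDegree ≤ N) (h : ∀ z ∈ V, A z * D z = E z) :
    CoeffAnalyticOn V D := by
  -- Descending induction on the coefficient index: coefficient `n + m` of `A D = E` reads `α D_m =
  -- E_{n+m} - ∑ A_p D_q` with `q > m`, and coefficients of `D` above `N` vanish.
  suffices H : ∀ k m, N + 1 ≤ m + k → AnalyticOnNhd ℂ (fun z => (D z).coeff m) V from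
    fun m => H (N + 1) m (by omega)
  intro k
  induction k with
  | zero =>
    intro m hm
    refine (analyticOnNhd_const (v := (0 : ℂ))).congr hV fun z hz => ?_
    exact (coeff_eq_zero_of_natDegree_lt (by have := hDdeg z hz; omega)).symm
  | succ k ih =>
    intro m hm
    have key : AnalyticOnNhd ℂ (fun z => α⁻¹ * ((E z).coeff (n + m) -
        ∑ p ∈ (Finset.HasAntidiagonal.antidiagonal (n + m)).filter (fun p => m < p.2),
          (A z).coeff p.1 * (D z).coeff p.2)) V := by
      refine AnalyticOnNhd.mul analyticOnNhd_const (AnalyticOnNhd.sub (hE _) ?_)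
      refine Finset.analyticOnNhd_fun_sum _ fun p hp => AnalyticOnNhd.mul (hA _) (ih _ ?_)
      have := (Finset.mem_filter.1 hp).2
      omega
    refine key.congr hV fun z hz => ?_
    have hsplit : (E z).coeff (n + m) =
        (∑ p ∈ (Finset.HasAntidiagonal.antidiagonal (n + m)).filter (fun p => m < p.2),
          (A z).coeff p.1 * (D z).coeff p.2) + α * (D z).coeff m := by
      rw [← h z hz, coeff_mul, ← Finset.sum_filter_add_sum_filter_not _ (fun p => m < p.2)]
      congr 1
      rw [Finset.sum_eq_single (n, m), hAlead z hz]
      -- Any other pair with second index at most `m` has first index above `n`, where `A` has no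
      -- coefficient.
      · rintro ⟨i, j⟩ hp hne
        simp only [Finset.mem_filter, Finset.HasAntidiagonal.mem_antidiagonal,
          not_lt] at hp
        have hi : n < i := by
          rcases lt_or_ge n i with hi | hi
          · exact hi
          · exact absurd (Prod.ext (by simp; omega) (by simp; omega)) hne
        rw [coeff_eq_zero_of_natDegree_lt ((hAdeg z hz).trans_lt hi), zero_mul]
      · intro hp
        simp at hp
    simp only [hsplit]
    field_simp
    ring

variable [DecidableEq ι]

/-- The polynomial whose coefficients are the partial derivatives of those of `P`. -/
noncomputable def coeffPderiv (N : ℕ) (a : ι) (P : (ι → ℂ) → ℂ[X]) (z : ι → ℂ) : ℂ[X] :=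
  ∑ m ∈ Finset.range (N + 1), C (pderiv a (fun w => (P w).coeff m) z) * X ^ m

theorem eval_derivative_eq_sum_range {p : ℂ[X]} {N : ℕ} (hp : p.natDegree ≤ N) (x : ℂ) :
    (derivative p).eval x = ∑ m ∈ Finset.range (N + 1), p.coeff m * (m * x ^ (m - 1)) := by
  rw [derivative_eval, sum_over_range' _ (by simp) _ (Nat.lt_succ_of_le hp)]
  exact Finset.sum_congr rfl fun m _ => by ring

/-- Chain rule at a moving point: one contribution from the coefficients, one from the displacement
of the point. -/
theorem pderiv_eval_coord_family (hV : IsOpen V) (hP : CoeffAnalyticOn V P) {N : ℕ}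
    (hdeg : ∀ z ∈ V, (P z).natDegree ≤ N) {z : ι → ℂ} (hz : z ∈ V) (a b : ι) :
    pderiv a (fun w => (P w).eval (w b)) z = (coeffPderiv N a P z).eval (z b)
      + if a = b then (derivative (P z)).eval (z b) else 0 := by
  have hcongr : (fun w => (P w).eval (w b)) =ᶠ[nhds z]
      fun w => ∑ m ∈ Finset.range (N + 1), (P w).coeff m * w b ^ m := by
    filter_upwards [hV.mem_nhds hz] with w hw
    exact eval_eq_sum_range' (Nat.lt_succ_of_le (hdeg w hw)) _
  have Dc : ∀ m, DifferentiableAt ℂ (fun w => (P w).coeff m) z :=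
    fun m => (hP m z hz).differentiableAt
  have Dx : ∀ m : ℕ, DifferentiableAt ℂ (fun w : ι → ℂ => w b ^ m) z :=
    fun m => ((analyticOnNhd_coord b V z hz).fun_pow m).differentiableAt
  rw [pderiv_congr hcongr, pderiv_sum fun m _ => (Dc m).fun_mul (Dx m)]
  have hpow : ∀ m : ℕ, pderiv a (fun w : ι → ℂ => w b ^ m) z =
      if a = b then m * z b ^ (m - 1) else 0 := fun m => pderiv_comp_coord (hasDerivAt_pow m (z b))
  simp only [pderiv_mul (Dc _) (Dx _), hpow, Finset.sum_add_distrib, coeffPderiv, eval_finsetSum,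
    eval_mul, eval_C, eval_pow, eval_X]
  rw [add_comm]
  congr 1
  by_cases hab : a = b
  · simp only [hab, if_true]
    exact (eval_derivative_eq_sum_range (hdeg z hz) _).symm
  · simp [hab]

theorem pderiv_eval_family (hV : IsOpen V) (hP : CoeffAnalyticOn V P) {N : ℕ}
    (hdeg : ∀ z ∈ V, (P z).natDegree ≤ N) {z : ι → ℂ} (hz : z ∈ V) (a : ι) (x : ℂ) :
    pderiv a (fun w => (P w).eval x) z = (coeffPderiv N a P z).eval x := by
  have hcongr : (fun w => (P w).eval x) =ᶠ[nhds z]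
      fun w => ∑ m ∈ Finset.range (N + 1), (P w).coeff m * x ^ m := by
    filter_upwards [hV.mem_nhds hz] with w hw
    exact eval_eq_sum_range' (Nat.lt_succ_of_le (hdeg w hw)) _
  have Dc : ∀ m, DifferentiableAt ℂ (fun w => (P w).coeff m) z :=
    fun m => (hP m z hz).differentiableAt
  rw [pderiv_congr hcongr, pderiv_sum fun m _ => (Dc m).fun_mul (differentiableAt_const _)]
  simp [pderiv_mul (Dc _) (differentiableAt_const _), coeffPderiv, eval_finsetSum]

/-- The constant top coefficient differentiates to zero; the drop in degree is what makes
interpolation at `n` nodes exact. -/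
theorem degree_coeffPderiv_lt (hV : IsOpen V) {N : ℕ} {c : ℂ}
    (hlead : ∀ z ∈ V, (P z).coeff N = c) {z : ι → ℂ} (hz : z ∈ V) (a : ι) :
    (coeffPderiv N a P z).degree < N := by
  rw [degree_lt_iff_coeff_zero]
  intro m hm
  simp only [coeffPderiv, finsetSum_coeff, coeff_C_mul_X_pow, Finset.sum_ite_eq]
  split_ifs with h
  · obtain rfl : m = N := by have := Finset.mem_range.1 h; omega
    rw [pderiv_congr (g := fun _ => c), pderiv_const]
    filter_upwards [hV.mem_nhds hz] with w hw using hlead w hw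
  · rfl

end CoefficientFamilies

/-! ### Lagrange interpolation at the roots of `A`. -/

section Interpolation

variable {n : ℕ} {α : ℂ} {z : Fin n ⊕ Fin n → ℂ}

theorem isOpen_domain (n : ℕ) : IsOpen (domain n) := by
  have : domain n = ⋂ (i : Fin n) (j : Fin n) (_ : i ≠ j), {z | z (Sum.inl i) ≠ z (Sum.inl j)} := by
    ext z
    simp only [domain, Function.Injective, Set.mem_ofPred_eq, Set.mem_iInter]
    exact ⟨fun h i j hij he => hij (h he), fun h i j he => by_contra fun hij => h i j hij he⟩
  rw [this]
  exact isOpen_iInter_of_finite fun i => isOpen_iInter_of_finite fun j =>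
    isOpen_iInter_of_finite fun _ => isOpen_ne_fun (continuous_apply _) (continuous_apply _)

theorem polyA_eq_nodal (α : ℂ) (z : Fin n ⊕ Fin n → ℂ) :
    polyA α z = C α * Lagrange.nodal Finset.univ fun i => z (Sum.inl i) := rfl

theorem degree_polyA (hα : α ≠ 0) (z : Fin n ⊕ Fin n → ℂ) : (polyA α z).degree = n := by
  rw [polyA_eq_nodal, degree_C_mul hα, Lagrange.degree_nodal, Finset.card_univ, Fintype.card_fin]

theorem natDegree_polyA (hα : α ≠ 0) (z : Fin n ⊕ Fin n → ℂ) : (polyA α z).natDegree = n :=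
  natDegree_eq_of_degree_eq_some (degree_polyA hα z)

theorem polyA_ne_zero (hα : α ≠ 0) (z : Fin n ⊕ Fin n → ℂ) : polyA α z ≠ 0 := by
  intro h
  simpa [h] using degree_polyA hα z

theorem coeff_polyA (α : ℂ) (z : Fin n ⊕ Fin n → ℂ) : (polyA α z).coeff n = α := by
  have h := (Lagrange.nodal_monic (s := Finset.univ) (v := fun i => z (Sum.inl i))).coeff_natDegree
  rw [Lagrange.natDegree_nodal, Finset.card_univ, Fintype.card_fin] at h
  rw [polyA_eq_nodal, coeff_C_mul, h, mul_one]

theorem eval_polyA_node (α : ℂ) (z : Fin n ⊕ Fin n → ℂ) (i : Fin n) :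
    (polyA α z).eval (z (Sum.inl i)) = 0 := by
  rw [polyA_eq_nodal, eval_mul, Lagrange.eval_nodal_at_node (v := fun i => z (Sum.inl i)) (Finset.mem_univ i), mul_zero]

theorem eval_derivative_polyA_node (α : ℂ) (z : Fin n ⊕ Fin n → ℂ) (i : Fin n) :
    (derivative (polyA α z)).eval (z (Sum.inl i)) =
      α * ∏ j ∈ Finset.univ.erase i, (z (Sum.inl i) - z (Sum.inl j)) := by
  rw [polyA_eq_nodal, derivative_C_mul, eval_mul, eval_C,
    Lagrange.eval_nodal_derivative_eval_node_eq (v := fun i => z (Sum.inl i))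
      (Finset.mem_univ i), Lagrange.eval_nodal]

theorem eval_derivative_polyA_ne_zero (hα : α ≠ 0) (hz : z ∈ domain n) (i : Fin n) :
    (derivative (polyA α z)).eval (z (Sum.inl i)) ≠ 0 := by
  rw [eval_derivative_polyA_node]
  refine mul_ne_zero hα (Finset.prod_ne_zero_iff.2 fun j hj => sub_ne_zero.2 fun h => ?_)
  exact (Finset.ne_of_mem_erase hj) (hz h).symm

theorem X_sub_C_mul_basisPoly (hα : α ≠ 0) (hz : z ∈ domain n) (i : Fin n) :
    (X - C (z (Sum.inl i))) * (C ((derivative (polyA α z)).eval (z (Sum.inl i))) *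
      basisPoly α z i) = polyA α z := by
  have h := eval_derivative_polyA_ne_zero hα hz i
  rw [basisPoly, ← mul_assoc (C _), ← C_mul, mul_div_cancel₀ _ h, polyA, mul_left_comm,
    Finset.mul_prod_erase _ (fun j => X - C (z (Sum.inl j))) (Finset.mem_univ i)]

theorem eval_basisPoly_node (hα : α ≠ 0) (hz : z ∈ domain n) (i j : Fin n) :
    (basisPoly α z i).eval (z (Sum.inl j)) = if i = j then 1 else 0 := by
  rw [basisPoly, eval_mul, eval_C, eval_prod]
  simp only [eval_sub, eval_X, eval_C]
  split_ifs with h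
  · subst h
    have h0 := eval_derivative_polyA_ne_zero hα hz i
    rw [div_mul_eq_mul_div, ← eval_derivative_polyA_node, div_self h0]
  · rw [Finset.prod_eq_zero (Finset.mem_erase.2 ⟨Ne.symm h, Finset.mem_univ j⟩) (sub_self _),
      mul_zero]

theorem degree_basisPoly_lt (α : ℂ) (z : Fin n ⊕ Fin n → ℂ) (i : Fin n) :
    (basisPoly α z i).degree < n := by
  refine (degree_mul_le _ _).trans_lt ?_
  refine (add_le_of_nonpos_left degree_C_le).trans_lt ?_
  rw [degree_prod]
  simp only [degree_X_sub_C, Finset.sum_const, Finset.card_erase_of_mem (Finset.mem_univ i),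
    Finset.card_univ, Fintype.card_fin, nsmul_eq_mul, mul_one]
  exact_mod_cast Nat.sub_lt i.pos one_pos

theorem degree_sum_basisPoly_lt (α : ℂ) (z : Fin n ⊕ Fin n → ℂ) (c : Fin n → ℂ) :
    (∑ i, C (c i) * basisPoly α z i).degree < n := by
  rw [degree_lt_iff_coeff_zero]
  intro m hm
  rw [finsetSum_coeff]
  refine Finset.sum_eq_zero fun i _ => ?_
  rw [coeff_C_mul, coeff_eq_zero_of_degree_lt
    ((degree_basisPoly_lt α z i).trans_le (by exact_mod_cast hm)), mul_zero]

theorem eval_sum_basisPoly_node (hα : α ≠ 0) (hz : z ∈ domain n) (c : Fin n → ℂ) (j : Fin n) :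
    (∑ i, C (c i) * basisPoly α z i).eval (z (Sum.inl j)) = c j := by
  simp [eval_finsetSum, eval_basisPoly_node hα hz]

theorem eq_of_eval_nodes_eq (hz : z ∈ domain n) {p q : ℂ[X]} (hp : p.degree < n)
    (hq : q.degree < n) (h : ∀ i, p.eval (z (Sum.inl i)) = q.eval (z (Sum.inl i))) : p = q :=
  Polynomial.eq_of_degrees_lt_of_eval_index_eq Finset.univ (v := fun i => z (Sum.inl i))
    (fun _ _ _ _ h => hz h) (by simpa using hp) (by simpa using hq) fun i _ => h i

theorem eq_sum_basisPoly (hα : α ≠ 0) (hz : z ∈ domain n) {p : ℂ[X]} (hp : p.degree < n) :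
    p = ∑ i, C (p.eval (z (Sum.inl i))) * basisPoly α z i :=
  eq_of_eval_nodes_eq hz hp (degree_sum_basisPoly_lt α z _) fun j =>
    (eval_sum_basisPoly_node hα hz (fun i => p.eval (z (Sum.inl i))) j).symm

/-- The partial derivatives of a polynomial family with constant leading coefficient are determined
by its values at the nodes. -/
theorem pderiv_eval_eq_sum_nodes (hα : α ≠ 0) {P : (Fin n ⊕ Fin n → ℂ) → ℂ[X]} {c : ℂ}
    (hP : CoeffAnalyticOn (domain n) P) (hdeg : ∀ z ∈ domain n, (P z).natDegree ≤ n)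
    (hlead : ∀ z ∈ domain n, (P z).coeff n = c) (hz : z ∈ domain n) (a : Fin n ⊕ Fin n) (x : ℂ) :
    pderiv a (fun w => (P w).eval x) z =
      ∑ j, (pderiv a (fun w => (P w).eval (w (Sum.inl j))) z
        - if a = Sum.inl j then (derivative (P z)).eval (z (Sum.inl j)) else 0)
        * (basisPoly α z j).eval x := by
  have hV := isOpen_domain n
  -- The differentiated polynomial is its own interpolant. Its value at `λ_j` is the derivative of
  -- the node value minus the part due to the motion of the node.
  rw [pderiv_eval_family hV hP hdeg hz,
    eq_sum_basisPoly hα hz (degree_coeffPderiv_lt hV hlead hz a), eval_finsetSum]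
  refine Finset.sum_congr rfl fun j _ => ?_
  rw [pderiv_eval_coord_family hV hP hdeg hz, add_sub_cancel_right, eval_mul, eval_C]

end Interpolation

/-! ### The right-hand side in entries, and its form for `k = 0, 1`. -/

section RightHandSide

/-- The right-hand side of the bracket relations, entry by entry, without the factor `η / (x - y)`.
Here `a, b, c, d` and `a', b', c', d'` are the values of the entries at `x` and at `y`. -/
def entryTable (u v a b c d a' b' c' d' ρB ρC ρD : ℂ) : Matrix (Fin 4) (Fin 4) ℂ :=
  !![0, u * a' * b - v * a * b' - a * a' * ρB, -(u * a' * b) + v * a * b' + a * a' * ρB, 0;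
    -(u * a' * c) + v * a * c' + a * a' * ρC, v * (b * c' - b' * c) - a' * c * ρB + a' * b * ρC,
      v * a * d' - u * a' * d + a * a' * ρD, v * (b * d' - b' * d) + a' * b * ρD - a' * d * ρB;
    u * a' * c - v * a * c' - a * a' * ρC, u * a' * d - v * a * d' - a * a' * ρD,
      u * (c * b' - c' * b) + a * c' * ρB - a * b' * ρC,
      u * (b' * d - b * d') - a * b' * ρD + a * d' * ρB;
    0, v * (c' * d - c * d') - a' * c * ρD + a' * d * ρC,
      u * (c * d' - c' * d) + a * c' * ρD - a * d' * ρC,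
      ρD * (b * c' - b' * c) + ρB * (c * d' - c' * d) + ρC * (b' * d - b * d')]

/-- In the chosen basis order the first tensor leg varies fastest, so a pair of first-leg indices
selects rows and columns of equal parity. The nested form separates the two legs. -/
theorem ofArray_apply (m00 m01 m02 m03 m10 m11 m12 m13 m20 m21 m22 m23 m30 m31 m32 m33 : ℂ)
    (i j k l : Fin 2) :
    ofArray !![m00, m01, m02, m03;
      m10, m11, m12, m13;
      m20, m21, m22, m23;
      m30, m31, m32, m33] (i, j) (k, l) =
    (!![!![m00, m02; m20, m22], !![m01, m03; m21, m23];
        !![m10, m12; m30, m32], !![m11, m13; m31, m33]] :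
      Matrix (Fin 2) (Fin 2) (Matrix (Fin 2) (Fin 2) ℂ)) i k j l := by
  fin_cases i <;> fin_cases j <;> fin_cases k <;> fin_cases l <;> rfl

theorem leg1_mul_leg2 (T : Matrix (Fin 2) (Fin 2) ℂ[X]) (x y : ℂ) :
    leg1 T x * leg2 T y = evalAt T x ⊗ₖ evalAt T y := by
  rw [leg1, leg2, ← Matrix.mul_kronecker_mul, mul_one, one_mul]

theorem s21_eq (η : ℂ) (k : ℕ) (T : Matrix (Fin 2) (Fin 2) ℂ[X]) (x y : ℂ) :
    s21 η k T x y = (η / (x - y)) • ofArray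
    !![0, 0, -rho k (T 0 0) (T 0 1) x y, 0;
       -rho k (T 0 0) (T 1 0) x y, (x ^ k - y ^ k) / 2, -rho k (T 0 0) (T 1 1) x y, 0;
       0, 0, (x ^ k - y ^ k) / 2, 0;
       0, 0, 0, 0] := by
  rw [s21, s12, permOp, Matrix.mul_smul, Matrix.smul_mul]
  congr 1
  ext ⟨i, j⟩ ⟨p, q⟩
  simp only [Matrix.mul_apply, Fintype.sum_prod_type, Fin.sum_univ_two, ofArray_apply]
  fin_cases i <;> fin_cases j <;> fin_cases p <;> fin_cases q <;> simp

theorem rsForm_eq (η : ℂ) (k : ℕ) (T : Matrix (Fin 2) (Fin 2) ℂ[X]) (x y : ℂ) :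
    rsForm η k T x y = (η / (x - y)) • ofArray (entryTable (x ^ k) (y ^ k)
      ((T 0 0).eval x) ((T 0 1).eval x) ((T 1 0).eval x) ((T 1 1).eval x)
      ((T 0 0).eval y) ((T 0 1).eval y) ((T 1 0).eval y) ((T 1 1).eval y)
      (rho k (T 0 0) (T 0 1) x y) (rho k (T 0 0) (T 1 0) x y) (rho k (T 0 0) (T 1 1) x y)) := by
  simp only [rsForm, mul_assoc, leg1_mul_leg2, s21_eq, r12, r21, s12, entryTable,
    Matrix.mul_smul, Matrix.smul_mul, ← smul_add, ← smul_sub]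
  congr 1
  -- The identity is polynomial in the `ρ`'s, whose origin as quotients plays no role.
  generalize rho k (T 0 0) (T 0 1) x y = ρB
  generalize rho k (T 0 0) (T 1 0) x y = ρC
  generalize rho k (T 0 0) (T 1 1) x y = ρD
  ext ⟨i, j⟩ ⟨p, q⟩
  simp only [leg1, leg2, evalAt, Matrix.sub_apply, Matrix.add_apply, Matrix.mul_apply,
    Fintype.sum_prod_type, Fin.sum_univ_two, Matrix.kroneckerMap_apply, Matrix.map_apply,
    Matrix.one_fin_two, ofArray_apply]
  fin_cases i <;> fin_cases j <;> fin_cases p <;> fin_cases q <;> simp <;> ring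

/-- Same table with both powers equal to `1` and all `ρ` zero, so the case `k = 0` reduces to
`rho_zero`. -/
theorem sklyaninForm_eq (η : ℂ) (T : Matrix (Fin 2) (Fin 2) ℂ[X]) (x y : ℂ) :
    sklyaninForm η T x y = (η / (x - y)) • ofArray (entryTable 1 1
      ((T 0 0).eval x) ((T 0 1).eval x) ((T 1 0).eval x) ((T 1 1).eval x)
      ((T 0 0).eval y) ((T 0 1).eval y) ((T 1 0).eval y) ((T 1 1).eval y) 0 0 0) := by
  simp only [sklyaninForm, permOp, leg1_mul_leg2, entryTable, Matrix.mul_smul, Matrix.smul_mul,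
    ← smul_sub]
  congr 1
  ext ⟨i, j⟩ ⟨p, q⟩
  simp only [evalAt, Matrix.sub_apply, Matrix.mul_apply, Fintype.sum_prod_type,
    Fin.sum_univ_two, Matrix.kroneckerMap_apply, Matrix.map_apply, ofArray_apply]
  fin_cases i <;> fin_cases j <;> fin_cases p <;> fin_cases q <;> simp <;> ring

theorem natDegree_div_le (p : ℂ[X]) {q : ℂ[X]} (hq : q ≠ 0) :
    (p / q).natDegree ≤ p.natDegree - q.natDegree := by
  rcases lt_or_ge p.degree q.degree with h | h
  · rw [(Polynomial.div_eq_zero_iff hq).2 h]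
    simp
  · have hp : p ≠ 0 := fun hp => hq (by simpa [hp] using h)
    have hd : p / q ≠ 0 := fun h0 => absurd ((Polynomial.div_eq_zero_iff hq).1 h0) (not_lt.2 h)
    have := degree_add_div hq h
    rw [degree_eq_natDegree hp, degree_eq_natDegree hq, degree_eq_natDegree hd] at this
    have : q.natDegree + (p / q).natDegree = p.natDegree := by exact_mod_cast this
    omega

variable {n : ℕ} {A Y : ℂ[X]}

/-- The quotient has degree zero, and `ρ` is a difference of two of its values. -/
theorem rho_zero (hA : A.natDegree ≤ n) (hA' : A.coeff n ≠ 0) (hY : Y.natDegree ≤ n) (x y : ℂ) :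
    rho 0 A Y x y = 0 := by
  have hA0 : A ≠ 0 := fun h => hA' (by simp [h])
  have hn : n ≤ A.natDegree := le_natDegree_of_ne_zero hA'
  have h := natDegree_div_le (X ^ 0 * Y) hA0
  rw [pow_zero, one_mul] at h
  rw [rho, pow_zero, one_mul, eq_C_of_natDegree_le_zero (p := Y / A) (by omega)]
  simp

/-- The quotient of `X * Y` is at most linear. Comparing coefficients at `n + 1`, which the
remainder does not reach, gives its slope; its constant term drops out of the difference. -/
theorem rho_one (hA : A.natDegree ≤ n) (hA' : A.coeff n ≠ 0) (hY : Y.natDegree ≤ n) (x y : ℂ) :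
    rho 1 A Y x y = Y.coeff n / A.coeff n * (x - y) := by
  have hA0 : A ≠ 0 := fun h => hA' (by simp [h])
  have hn : n ≤ A.natDegree := le_natDegree_of_ne_zero hA'
  have hXY : (X * Y).natDegree ≤ 1 + n := natDegree_mul_le_of_le natDegree_X_le hY
  have hq : ((X * Y) / A).natDegree ≤ 1 := by
    have := natDegree_div_le (X * Y) hA0
    omega
  have hcoeff : ((X * Y) / A).coeff 1 * A.coeff n = Y.coeff n := by
    have h := congrArg (fun p => p.coeff (n + 1)) (EuclideanDomain.div_add_mod (X * Y) A)
    have hr : ((X * Y) % A).coeff (n + 1) = 0 := by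
      refine coeff_eq_zero_of_degree_lt ((Polynomial.degree_mod_lt _ hA0).trans_le ?_)
      exact (degree_le_natDegree).trans (by exact_mod_cast (by omega : A.natDegree ≤ n + 1))
    simp only [coeff_add, hr, add_zero, coeff_X_mul] at h
    rw [coeff_mul_add_eq_of_natDegree_le hA hq] at h
    rw [← h, mul_comm]
  rw [rho, pow_one, eq_X_add_C_of_natDegree_le_one hq]
  simp only [eval_add, eval_mul, eval_C, eval_X, ← hcoeff]
  field_simp
  ring

theorem rsForm_zero_eq_sklyaninForm {T : Matrix (Fin 2) (Fin 2) ℂ[X]}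
    (hT : ∀ i j, (T i j).natDegree ≤ n) (hT' : (T 0 0).coeff n ≠ 0) (η x y : ℂ) :
    rsForm η 0 T x y = sklyaninForm η T x y := by
  rw [rsForm_eq, sklyaninForm_eq, rho_zero (hT 0 0) hT' (hT 0 1), rho_zero (hT 0 0) hT' (hT 1 0),
    rho_zero (hT 0 0) hT' (hT 1 1), pow_zero, pow_zero]

theorem isFirstBracket_rsForm {T : Matrix (Fin 2) (Fin 2) ℂ[X]}
    (hT : ∀ i j, (T i j).natDegree ≤ n) (hT' : (T 0 0).coeff n ≠ 0) (η : ℂ) :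
    IsFirstBracket η n T (rsForm η 1 T) := by
  have key : ∀ x y, rsForm η 1 T x y = _ := fun x y => rsForm_eq η 1 T x y
  simp only [rho_one (hT 0 0) hT' (hT 0 1), rho_one (hT 0 0) hT' (hT 1 0),
    rho_one (hT 0 0) hT' (hT 1 1), pow_one] at key
  constructor
  · rintro ⟨i, j⟩ ⟨p, q⟩ x y hxy
    have h1 : x - y ≠ 0 := sub_ne_zero.2 hxy
    have h2 : y - x = -(x - y) := by ring
    simp only [key, h2, div_neg, Matrix.smul_apply, entryTable, ofArray_apply]
    -- The exchange of `x` and `y` only flips the sign of this factor, which can then stay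
    -- indeterminate.
    generalize η / (x - y) = r
    fin_cases i <;> fin_cases j <;> fin_cases p <;> fin_cases q <;> simp [-mul_eq_mul_left_iff] <;> ring
  all_goals
    intro x y hxy
    have h1 : x - y ≠ 0 := sub_ne_zero.2 hxy
    simp [key, entryTable, ofArray_apply]
  all_goals
    field_simp
    try ring

end RightHandSide

/-! ### The entries of `T`: degrees, node values, holomorphy, derivatives. -/

section Entries

variable {n : ℕ} {α β γ δ η : ℂ} {d : ℂ[X]} {z : Fin n ⊕ Fin n → ℂ}

theorem natDegree_add_sum_basisPoly_le (hα : α ≠ 0) (b : ℂ) (v : Fin n → ℂ) :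
    (C b * polyA α z + ∑ i, C (v i) * basisPoly α z i).natDegree ≤ n := by
  refine natDegree_add_le_of_degree_le ?_ ?_
  · exact (natDegree_C_mul_le _ _).trans (natDegree_polyA hα z).le
  · exact natDegree_le_iff_degree_le.2 (degree_sum_basisPoly_lt α z v).le

theorem coeff_add_sum_basisPoly (b : ℂ) (v : Fin n → ℂ) :
    (C b * polyA α z + ∑ i, C (v i) * basisPoly α z i).coeff n = b * α := by
  rw [coeff_add, coeff_C_mul, coeff_polyA,
    coeff_eq_zero_of_degree_lt (degree_sum_basisPoly_lt α z v), add_zero]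

/-- Gives `C` the shape of `B`, so that both share the lemmas on degree, leading coefficient and
node values. -/
theorem polyC_eq (α γ η : ℂ) (d : ℂ[X]) (z : Fin n ⊕ Fin n → ℂ) :
    polyC α γ η d z = C (γ / α) * polyA α z +
      ∑ i, C (-(d.eval (z (Sum.inl i)) * Complex.exp (η * z (Sum.inr i)))) * basisPoly α z i := by
  simp [polyC, sub_eq_add_neg]

theorem natDegree_polyB_le (hα : α ≠ 0) : (polyB α β η z).natDegree ≤ n :=
  natDegree_add_sum_basisPoly_le hα _ fun i => Complex.exp (-(η * z (Sum.inr i)))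

theorem natDegree_polyC_le (hα : α ≠ 0) : (polyC α γ η d z).natDegree ≤ n := by
  rw [polyC_eq]
  exact natDegree_add_sum_basisPoly_le hα _
    fun i => -(d.eval (z (Sum.inl i)) * Complex.exp (η * z (Sum.inr i)))

theorem coeff_polyB (hα : α ≠ 0) : (polyB α β η z).coeff n = β := by
  rw [polyB, coeff_add_sum_basisPoly _ fun i => Complex.exp (-(η * z (Sum.inr i))),
    div_mul_cancel₀ _ hα]

theorem coeff_polyC (hα : α ≠ 0) : (polyC α γ η d z).coeff n = γ := by
  rw [polyC_eq, coeff_add_sum_basisPoly _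
    fun i => -(d.eval (z (Sum.inl i)) * Complex.exp (η * z (Sum.inr i))), div_mul_cancel₀ _ hα]

theorem eval_polyB_node (hα : α ≠ 0) (hz : z ∈ domain n) (i : Fin n) :
    (polyB α β η z).eval (z (Sum.inl i)) = Complex.exp (-(η * z (Sum.inr i))) := by
  rw [polyB, eval_add, eval_mul, eval_polyA_node, mul_zero, zero_add,
    eval_sum_basisPoly_node hα hz fun i => Complex.exp (-(η * z (Sum.inr i)))]

theorem eval_polyC_node (hα : α ≠ 0) (hz : z ∈ domain n) (i : Fin n) :
    (polyC α γ η d z).eval (z (Sum.inl i)) =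
      -(d.eval (z (Sum.inl i)) * Complex.exp (η * z (Sum.inr i))) := by
  rw [polyC_eq, eval_add, eval_mul, eval_polyA_node, mul_zero, zero_add,
    eval_sum_basisPoly_node hα hz
      fun i => -(d.eval (z (Sum.inl i)) * Complex.exp (η * z (Sum.inr i)))]

theorem eval_polyB_mul_polyC_node (hα : α ≠ 0) (hz : z ∈ domain n) (i : Fin n) :
    (polyB α β η z).eval (z (Sum.inl i)) * (polyC α γ η d z).eval (z (Sum.inl i)) =
      -d.eval (z (Sum.inl i)) := by
  rw [eval_polyB_node hα hz, eval_polyC_node hα hz, Complex.exp_neg]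
  field_simp [Complex.exp_ne_zero]

/-- At each node `B C = -d`, so the remainder of `d + B C` modulo `A` vanishes at `n` distinct
points; having degree below `n`, it is zero. -/
theorem polyA_mul_polyD (hα : α ≠ 0) (hz : z ∈ domain n) :
    polyA α z * polyD α β γ η d z = d + polyB α β η z * polyC α γ η d z := by
  have hA := polyA_ne_zero hα z
  have hmod : (d + polyB α β η z * polyC α γ η d z) % polyA α z = 0 := by
    refine eq_of_eval_nodes_eq hz ?_ (by simp) fun i => ?_
    · exact (Polynomial.degree_mod_lt _ hA).trans_le (degree_polyA hα z).le
    · have h := congrArg (eval (z (Sum.inl i)))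
        (EuclideanDomain.div_add_mod (d + polyB α β η z * polyC α γ η d z) (polyA α z))
      rw [eval_add, eval_mul, eval_polyA_node, zero_mul, zero_add] at h
      rw [h, eval_add, eval_mul, eval_polyB_mul_polyC_node hα hz, eval_zero, add_neg_cancel]
  have h := EuclideanDomain.div_add_mod (d + polyB α β η z * polyC α γ η d z) (polyA α z)
  rwa [hmod, add_zero] at h

theorem natDegree_polyD_le (hα : α ≠ 0) (hd : d.natDegree ≤ 2 * n) :
    (polyD α β γ η d z).natDegree ≤ n := by
  have h := natDegree_div_le (d + polyB α β η z * polyC α γ η d z) (polyA_ne_zero hα z)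
  have h' : (d + polyB α β η z * polyC α γ η d z).natDegree ≤ 2 * n := by
    refine natDegree_add_le_of_degree_le hd ?_
    rw [two_mul]
    exact natDegree_mul_le_of_le (natDegree_polyB_le hα) (natDegree_polyC_le hα)
  rw [natDegree_polyA hα] at h
  exact h.trans (by omega)

/-- Comparison of the coefficients of `λ^{2n}` in `A D = d + B C`. -/
theorem coeff_polyD (hα : α ≠ 0) (hd : d.natDegree ≤ 2 * n)
    (hd' : d.coeff (2 * n) = α * δ - β * γ) (hz : z ∈ domain n) :
    (polyD α β γ η d z).coeff n = δ := by
  have h := congrArg (fun p => p.coeff (n + n)) (polyA_mul_polyD (β := β) (γ := γ) (η := η)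
    (d := d) hα hz)
  simp only [coeff_add] at h
  rw [coeff_mul_add_eq_of_natDegree_le (natDegree_polyA hα z).le (natDegree_polyD_le hα hd),
    coeff_mul_add_eq_of_natDegree_le (natDegree_polyB_le hα) (natDegree_polyC_le hα),
    coeff_polyA, coeff_polyB hα, coeff_polyC hα, ← two_mul, hd', sub_add_cancel] at h
  exact mul_left_cancel₀ hα h

theorem det_matT (hα : α ≠ 0) (hz : z ∈ domain n) : (matT α β γ η d z).det = d := by
  rw [matT, Matrix.det_fin_two_of, polyA_mul_polyD hα hz, add_sub_cancel_right]

theorem coeffAnalyticOn_polyA (α : ℂ) (V : Set (Fin n ⊕ Fin n → ℂ)) :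
    CoeffAnalyticOn V (polyA α) :=
  (CoeffAnalyticOn.const _).mul (.prod fun i _ =>
    (CoeffAnalyticOn.const X).sub (.monomialZero (analyticOnNhd_coord (Sum.inl i) V)))

theorem coeffAnalyticOn_basisPoly (hα : α ≠ 0) (i : Fin n) :
    CoeffAnalyticOn (domain n) fun z => basisPoly α z i := by
  refine (CoeffAnalyticOn.monomialZero ?_).mul (.prod fun j _ =>
    (CoeffAnalyticOn.const X).sub (.monomialZero (analyticOnNhd_coord (Sum.inl j) _)))
  refine AnalyticOnNhd.div analyticOnNhd_const ?_
    fun z hz => eval_derivative_polyA_ne_zero hα hz i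
  exact (coeffAnalyticOn_polyA α _).derivative.eval (isOpen_domain n)
    (fun z _ => (natDegree_derivative_le _).trans (Nat.sub_le _ _ |>.trans
      (natDegree_polyA hα z).le)) (analyticOnNhd_coord _ _)

theorem coeffAnalyticOn_polyB (hα : α ≠ 0) :
    CoeffAnalyticOn (domain n) fun z => polyB α β η z := by
  refine ((CoeffAnalyticOn.const _).mul (coeffAnalyticOn_polyA α _)).add
    (.sum fun i _ => (CoeffAnalyticOn.monomialZero ?_).mul (coeffAnalyticOn_basisPoly hα i))
  exact fun z hz =>
    ((analyticAt_const.fun_mul (analyticOnNhd_coord (Sum.inr i) _ z hz)).fun_neg).cexp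

theorem coeffAnalyticOn_polyC (hα : α ≠ 0) :
    CoeffAnalyticOn (domain n) fun z => polyC α γ η d z := by
  refine ((CoeffAnalyticOn.const _).mul (coeffAnalyticOn_polyA α _)).sub
    (.sum fun i _ => (CoeffAnalyticOn.monomialZero ?_).mul (coeffAnalyticOn_basisPoly hα i))
  exact fun z hz => (analyticOnNhd_eval_coord d (Sum.inl i) _ z hz).fun_mul
    (analyticAt_const.fun_mul (analyticOnNhd_coord (Sum.inr i) _ z hz)).cexp

/-- Euclidean division hides the dependence on the point; exactness and the constant leading
coefficient of `A` recover it. -/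
theorem coeffAnalyticOn_polyD (hα : α ≠ 0) (hd : d.natDegree ≤ 2 * n) :
    CoeffAnalyticOn (domain n) fun z => polyD α β γ η d z :=
  CoeffAnalyticOn.of_mul_eq (isOpen_domain n) hα (coeffAnalyticOn_polyA α _)
    ((CoeffAnalyticOn.const d).add ((coeffAnalyticOn_polyB hα).mul (coeffAnalyticOn_polyC hα)))
    (fun z _ => (natDegree_polyA hα z).le) (fun z _ => coeff_polyA α z)
    (fun _ _ => natDegree_polyD_le hα hd) fun _ hz => polyA_mul_polyD hα hz

theorem natDegree_matT_le (hα : α ≠ 0) (hd : d.natDegree ≤ 2 * n) (i j : Fin 2) :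
    (matT α β γ η d z i j).natDegree ≤ n := by
  fin_cases i <;> fin_cases j
  · exact (natDegree_polyA hα z).le
  · exact natDegree_polyB_le hα
  · exact natDegree_polyC_le hα
  · exact natDegree_polyD_le hα hd

theorem coeffAnalyticOn_matT (hα : α ≠ 0) (hd : d.natDegree ≤ 2 * n) (i j : Fin 2) :
    CoeffAnalyticOn (domain n) fun z => matT α β γ η d z i j := by
  fin_cases i <;> fin_cases j
  · exact coeffAnalyticOn_polyA α _
  · exact coeffAnalyticOn_polyB hα
  · exact coeffAnalyticOn_polyC hα
  · exact coeffAnalyticOn_polyD hα hd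

theorem analyticOnNhd_eval_matT (hα : α ≠ 0) (hd : d.natDegree ≤ 2 * n) (i j : Fin 2) (x : ℂ) :
    AnalyticOnNhd ℂ (fun z => (matT α β γ η d z i j).eval x) (domain n) :=
  (coeffAnalyticOn_matT hα hd i j).eval (isOpen_domain n)
    (fun _ _ => natDegree_matT_le hα hd i j) analyticOnNhd_const

/-- The node values are identically zero, so only the motion of the nodes contributes. -/
theorem pderiv_eval_polyA (hα : α ≠ 0) (hz : z ∈ domain n) (x : ℂ) (i : Fin n) :
    pderiv (Sum.inl i) (fun w => (polyA α w).eval x) z =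
      -(derivative (polyA α z)).eval (z (Sum.inl i)) * (basisPoly α z i).eval x ∧
    pderiv (Sum.inr i) (fun w => (polyA α w).eval x) z = 0 := by
  have h := fun a => pderiv_eval_eq_sum_nodes hα (coeffAnalyticOn_polyA α (domain n))
    (fun z _ => (natDegree_polyA hα z).le) (fun z _ => coeff_polyA α z) hz a x
  simp only [eval_polyA_node, pderiv_const] at h
  constructor <;> simp [h]

theorem pderiv_eval_polyB (hα : α ≠ 0) (hz : z ∈ domain n) (x : ℂ) (i : Fin n) :
    pderiv (Sum.inl i) (fun w => (polyB α β η w).eval x) z =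
      -(derivative (polyB α β η z)).eval (z (Sum.inl i)) * (basisPoly α z i).eval x ∧
    pderiv (Sum.inr i) (fun w => (polyB α β η w).eval x) z =
      -(η * (polyB α β η z).eval (z (Sum.inl i))) * (basisPoly α z i).eval x := by
  have h := fun a => pderiv_eval_eq_sum_nodes hα (coeffAnalyticOn_polyB (β := β) (η := η) hα)
    (fun z _ => natDegree_polyB_le hα) (fun z _ => coeff_polyB hα) hz a x
  have hnode : ∀ a j, pderiv a (fun w => (polyB α β η w).eval (w (Sum.inl j))) z =
      if a = Sum.inr j then -(η * (polyB α β η z).eval (z (Sum.inl j))) else 0 := by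
    intro a j
    -- The node value is known on the open domain only, which suffices for a derivative at `z`.
    rw [pderiv_congr (g := fun w => Complex.exp (-(η * w (Sum.inr j)))),
      eval_polyB_node hα hz, pderiv_comp_coord (h := fun m => Complex.exp (-(η * m)))
        (((hasDerivAt_id _).const_mul η).neg.cexp)]
    · simp [mul_comm]
    · filter_upwards [(isOpen_domain n).mem_nhds hz] with w hw using eval_polyB_node hα hw j
  simp only [hnode] at h
  constructor <;> simp [h]

/-- Unlike for `B`, the node value depends on `λ_i` as well, through `d`; hence the extra term with
`d'`. -/
theorem pderiv_eval_polyC (hα : α ≠ 0) (hz : z ∈ domain n) (x : ℂ) (i : Fin n) :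
    pderiv (Sum.inl i) (fun w => (polyC α γ η d w).eval x) z =
      (-((derivative d).eval (z (Sum.inl i)) * Complex.exp (η * z (Sum.inr i)))
        - (derivative (polyC α γ η d z)).eval (z (Sum.inl i))) * (basisPoly α z i).eval x ∧
    pderiv (Sum.inr i) (fun w => (polyC α γ η d w).eval x) z =
      η * (polyC α γ η d z).eval (z (Sum.inl i)) * (basisPoly α z i).eval x := by
  have h := fun a => pderiv_eval_eq_sum_nodes hα
    (coeffAnalyticOn_polyC (γ := γ) (η := η) (d := d) hα)
    (fun z _ => natDegree_polyC_le hα) (fun z _ => coeff_polyC hα) hz a x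
  have hnode : ∀ a j, pderiv a (fun w => (polyC α γ η d w).eval (w (Sum.inl j))) z =
      (if a = Sum.inl j then
        -((derivative d).eval (z (Sum.inl j)) * Complex.exp (η * z (Sum.inr j))) else 0) +
      if a = Sum.inr j then η * (polyC α γ η d z).eval (z (Sum.inl j)) else 0 := by
    intro a j
    have hexp : HasDerivAt (fun m => Complex.exp (η * m))
        (Complex.exp (η * z (Sum.inr j)) * (η * 1)) (z (Sum.inr j)) :=
      ((hasDerivAt_id _).const_mul η).cexp
    have hd1 : DifferentiableAt ℂ (fun w : Fin n ⊕ Fin n → ℂ => -(d.eval (w (Sum.inl j)))) z :=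
      (analyticOnNhd_eval_coord d (Sum.inl j) Set.univ z trivial).differentiableAt.fun_neg
    have hd2 : DifferentiableAt ℂ (fun w : Fin n ⊕ Fin n → ℂ => Complex.exp (η * w (Sum.inr j))) z :=
      ((differentiableAt_const η).fun_mul
        (analyticOnNhd_coord (Sum.inr j) Set.univ z trivial).differentiableAt).cexp
    rw [pderiv_congr (g := fun w => -(d.eval (w (Sum.inl j))) * Complex.exp (η * w (Sum.inr j))),
      eval_polyC_node hα hz, pderiv_mul hd1 hd2,
      pderiv_comp_coord (h := fun m => Complex.exp (η * m)) hexp,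
      pderiv_comp_coord (h := fun m => -(d.eval m)) (d.hasDerivAt _).fun_neg]
    · split_ifs <;> ring
    · filter_upwards [(isOpen_domain n).mem_nhds hz] with w hw
      rw [eval_polyC_node hα hw, neg_mul]
  simp only [hnode] at h
  constructor <;> simp [h, sub_mul, Finset.sum_sub_distrib]

end Entries

/-! ### Extension of the brackets from `A`, `B`, `C` to `D`. -/

section EntryBrackets

/-- A skew pairing `F` of the entries of `T` which takes prescribed values on `A`, `B`, `C`, and is
extended to `D` by the derivation property, `A D - B C` being a Casimir element. -/
structure EntryBrackets (η : ℂ) (k : ℕ) (T : Matrix (Fin 2) (Fin 2) ℂ[X])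
    (F : Fin 2 × Fin 2 → Fin 2 × Fin 2 → ℂ → ℂ → ℂ) : Prop where
  skew : ∀ s t x y, F s t x y = -F t s y x
  poly : ∀ t y, ∃ p : ℂ[X], ∀ x, F (1, 1) t x y = p.eval x
  casimir : ∀ t x y, (T 0 0).eval x * F (1, 1) t x y = (T 1 0).eval x * F (0, 1) t x y
    + (T 0 1).eval x * F (1, 0) t x y - (T 1 1).eval x * F (0, 0) t x y
  AA : ∀ x y, F (0, 0) (0, 0) x y = 0
  BB : ∀ x y, F (0, 1) (0, 1) x y = 0
  CC : ∀ x y, F (1, 0) (1, 0) x y = 0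
  AB : ∀ x y, (x - y) * F (0, 0) (0, 1) x y =
    η * (-(x ^ k * (T 0 0).eval y * (T 0 1).eval x) + y ^ k * (T 0 0).eval x * (T 0 1).eval y
      + (T 0 0).eval x * (T 0 0).eval y * rho k (T 0 0) (T 0 1) x y)
  AC : ∀ x y, (x - y) * F (0, 0) (1, 0) x y =
    η * (x ^ k * (T 0 0).eval y * (T 1 0).eval x - y ^ k * (T 0 0).eval x * (T 1 0).eval y
      - (T 0 0).eval x * (T 0 0).eval y * rho k (T 0 0) (T 1 0) x y)
  BC : ∀ x y, (x - y) * F (0, 1) (1, 0) x y =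
    η * (x ^ k * (T 0 0).eval y * (T 1 1).eval x - y ^ k * (T 0 0).eval x * (T 1 1).eval y
      - (T 0 0).eval x * (T 0 0).eval y * rho k (T 0 0) (T 1 1) x y)

namespace EntryBrackets

variable {η : ℂ} {k : ℕ} {T : Matrix (Fin 2) (Fin 2) ℂ[X]}
  {F : Fin 2 × Fin 2 → Fin 2 × Fin 2 → ℂ → ℂ → ℂ}

theorem rho_swap (k : ℕ) (A Y : ℂ[X]) (x y : ℂ) : rho k A Y x y = -rho k A Y y x := by
  rw [rho, rho, neg_sub]

theorem BA (h : EntryBrackets η k T F) (x y : ℂ) : (x - y) * F (0, 1) (0, 0) x y =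
    η * (x ^ k * (T 0 0).eval y * (T 0 1).eval x - y ^ k * (T 0 0).eval x * (T 0 1).eval y
      - (T 0 0).eval x * (T 0 0).eval y * rho k (T 0 0) (T 0 1) x y) := by
  rw [h.skew, rho_swap]
  linear_combination h.AB y x

theorem CA (h : EntryBrackets η k T F) (x y : ℂ) : (x - y) * F (1, 0) (0, 0) x y =
    η * (-(x ^ k * (T 0 0).eval y * (T 1 0).eval x) + y ^ k * (T 0 0).eval x * (T 1 0).eval y
      + (T 0 0).eval x * (T 0 0).eval y * rho k (T 0 0) (T 1 0) x y) := by
  rw [h.skew, rho_swap]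
  linear_combination h.AC y x

theorem CB (h : EntryBrackets η k T F) (x y : ℂ) : (x - y) * F (1, 0) (0, 1) x y =
    η * (y ^ k * (T 0 0).eval x * (T 1 1).eval y - x ^ k * (T 0 0).eval y * (T 1 1).eval x
      + (T 0 0).eval x * (T 0 0).eval y * rho k (T 0 0) (T 1 1) x y) := by
  rw [h.skew, rho_swap]
  linear_combination h.BC y x

/-- The value of a bracket `{D(x), ·}` may be checked after multiplication by `A(x)`. -/
theorem eval_eq_of_mul_left (h : EntryBrackets η k T F) (hA : T 0 0 ≠ 0) (t : Fin 2 × Fin 2)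
    (y : ℂ) (q : ℂ[X]) (hq : ∀ x, (T 0 0).eval x * ((x - y) * F (1, 1) t x y) =
      (T 0 0).eval x * q.eval x) (x : ℂ) : (x - y) * F (1, 1) t x y = q.eval x := by
  obtain ⟨p, hp⟩ := h.poly t y
  -- Cancelling the nonzero polynomial `A` in `ℂ[X]` also covers the values `x` at which `A`
  -- vanishes.
  have hpq : (X - C y) * p = q := by
    refine mul_left_cancel₀ hA (Polynomial.funext fun x => ?_)
    simpa [hp] using hq x
  rw [← hpq, hp]
  simp

theorem DA (h : EntryBrackets η k T F) (hA : T 0 0 ≠ 0) (x y : ℂ) :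
    (x - y) * F (1, 1) (0, 0) x y =
    η * (y ^ k * ((T 0 1).eval x * (T 1 0).eval y - (T 0 1).eval y * (T 1 0).eval x)
      - (T 0 0).eval y * (T 1 0).eval x * rho k (T 0 0) (T 0 1) x y
      + (T 0 0).eval y * (T 0 1).eval x * rho k (T 0 0) (T 1 0) x y) := by
  -- The witness is the claimed right-hand side as a polynomial in `x`, with `y` frozen. In the
  -- combination given by `casimir` the terms in `x ^ k` cancel, and what remains carries the factor
  -- `A(x)`.
  have key := h.eval_eq_of_mul_left hA (0, 0) y
    (C η * (C (y ^ k) * (T 0 1 * C ((T 1 0).eval y) - C ((T 0 1).eval y) * T 1 0)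
      - C ((T 0 0).eval y) * T 1 0 *
        ((X ^ k * T 0 1) / T 0 0 - C (((X ^ k * T 0 1) / T 0 0).eval y))
      + C ((T 0 0).eval y) * T 0 1 *
        ((X ^ k * T 1 0) / T 0 0 - C (((X ^ k * T 1 0) / T 0 0).eval y)))) ?_ x
  · simpa only [eval_mul, eval_add, eval_sub, eval_C, rho] using key
  · intro x
    simp only [eval_mul, eval_add, eval_sub, eval_C]
    have hBA := h.BA x y
    have hCA := h.CA x y
    rw [rho] at hBA hCA
    linear_combination (x - y) * h.casimir (0, 0) x y + (T 1 0).eval x * hBA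
      + (T 0 1).eval x * hCA - (x - y) * (T 1 1).eval x * h.AA x y

theorem DB (h : EntryBrackets η k T F) (hA : T 0 0 ≠ 0) (x y : ℂ) :
    (x - y) * F (1, 1) (0, 1) x y =
    η * (y ^ k * ((T 0 1).eval x * (T 1 1).eval y - (T 0 1).eval y * (T 1 1).eval x)
      + (T 0 0).eval y * (T 0 1).eval x * rho k (T 0 0) (T 1 1) x y
      - (T 0 0).eval y * (T 1 1).eval x * rho k (T 0 0) (T 0 1) x y) := by
  have key := h.eval_eq_of_mul_left hA (0, 1) y
    (C η * (C (y ^ k) * (T 0 1 * C ((T 1 1).eval y) - C ((T 0 1).eval y) * T 1 1)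
      + C ((T 0 0).eval y) * T 0 1 *
        ((X ^ k * T 1 1) / T 0 0 - C (((X ^ k * T 1 1) / T 0 0).eval y))
      - C ((T 0 0).eval y) * T 1 1 *
        ((X ^ k * T 0 1) / T 0 0 - C (((X ^ k * T 0 1) / T 0 0).eval y)))) ?_ x
  · simpa only [eval_mul, eval_add, eval_sub, eval_C, rho] using key
  · intro x
    simp only [eval_mul, eval_add, eval_sub, eval_C]
    have hAB := h.AB x y
    have hCB := h.CB x y
    rw [rho] at hAB hCB
    linear_combination (x - y) * h.casimir (0, 1) x y + (x - y) * (T 1 0).eval x * h.BB x y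
      + (T 0 1).eval x * hCB - (T 1 1).eval x * hAB

theorem DC (h : EntryBrackets η k T F) (hA : T 0 0 ≠ 0) (x y : ℂ) :
    (x - y) * F (1, 1) (1, 0) x y =
    η * (y ^ k * ((T 1 0).eval y * (T 1 1).eval x - (T 1 0).eval x * (T 1 1).eval y)
      - (T 0 0).eval y * (T 1 0).eval x * rho k (T 0 0) (T 1 1) x y
      + (T 0 0).eval y * (T 1 1).eval x * rho k (T 0 0) (T 1 0) x y) := by
  have key := h.eval_eq_of_mul_left hA (1, 0) y
    (C η * (C (y ^ k) * (C ((T 1 0).eval y) * T 1 1 - T 1 0 * C ((T 1 1).eval y))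
      - C ((T 0 0).eval y) * T 1 0 *
        ((X ^ k * T 1 1) / T 0 0 - C (((X ^ k * T 1 1) / T 0 0).eval y))
      + C ((T 0 0).eval y) * T 1 1 *
        ((X ^ k * T 1 0) / T 0 0 - C (((X ^ k * T 1 0) / T 0 0).eval y)))) ?_ x
  · simpa only [eval_mul, eval_add, eval_sub, eval_C, rho] using key
  · intro x
    simp only [eval_mul, eval_add, eval_sub, eval_C]
    have hAC := h.AC x y
    have hBC := h.BC x y
    rw [rho] at hAC hBC
    linear_combination (x - y) * h.casimir (1, 0) x y + (x - y) * (T 0 1).eval x * h.CC x y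
      + (T 1 0).eval x * hBC - (T 1 1).eval x * hAC

theorem AD (h : EntryBrackets η k T F) (hA : T 0 0 ≠ 0) (x y : ℂ) :
    (x - y) * F (0, 0) (1, 1) x y =
    η * (x ^ k * ((T 1 0).eval x * (T 0 1).eval y - (T 1 0).eval y * (T 0 1).eval x)
      + (T 0 0).eval x * (T 1 0).eval y * rho k (T 0 0) (T 0 1) x y
      - (T 0 0).eval x * (T 0 1).eval y * rho k (T 0 0) (T 1 0) x y) := by
  rw [h.skew, rho_swap k _ _ x y, rho_swap k _ (T 1 0) x y]
  linear_combination h.DA hA y x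

theorem BD (h : EntryBrackets η k T F) (hA : T 0 0 ≠ 0) (x y : ℂ) :
    (x - y) * F (0, 1) (1, 1) x y =
    η * (x ^ k * ((T 0 1).eval y * (T 1 1).eval x - (T 0 1).eval x * (T 1 1).eval y)
      - (T 0 0).eval x * (T 0 1).eval y * rho k (T 0 0) (T 1 1) x y
      + (T 0 0).eval x * (T 1 1).eval y * rho k (T 0 0) (T 0 1) x y) := by
  rw [h.skew, rho_swap k _ (T 0 1) x y, rho_swap k _ (T 1 1) x y]
  linear_combination h.DB hA y x

theorem CD (h : EntryBrackets η k T F) (hA : T 0 0 ≠ 0) (x y : ℂ) :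
    (x - y) * F (1, 0) (1, 1) x y =
    η * (x ^ k * ((T 1 0).eval x * (T 1 1).eval y - (T 1 0).eval y * (T 1 1).eval x)
      + (T 0 0).eval x * (T 1 0).eval y * rho k (T 0 0) (T 1 1) x y
      - (T 0 0).eval x * (T 1 1).eval y * rho k (T 0 0) (T 1 0) x y) := by
  rw [h.skew, rho_swap k _ (T 1 0) x y, rho_swap k _ (T 1 1) x y]
  linear_combination h.DC hA y x

/-- `casimir` is applied once more, now with `D(y)` as second argument; its inputs `AD`, `BD`, `CD`
are the previous brackets transposed by skewness. -/
theorem DD (h : EntryBrackets η k T F) (hA : T 0 0 ≠ 0) (x y : ℂ) :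
    (x - y) * F (1, 1) (1, 1) x y =
    η * (rho k (T 0 0) (T 1 1) x y *
          ((T 0 1).eval x * (T 1 0).eval y - (T 0 1).eval y * (T 1 0).eval x)
      + rho k (T 0 0) (T 0 1) x y *
          ((T 1 0).eval x * (T 1 1).eval y - (T 1 0).eval y * (T 1 1).eval x)
      + rho k (T 0 0) (T 1 0) x y *
          ((T 0 1).eval y * (T 1 1).eval x - (T 0 1).eval x * (T 1 1).eval y)) := by
  have key := h.eval_eq_of_mul_left hA (1, 1) y
    (C η * (((X ^ k * T 1 1) / T 0 0 - C (((X ^ k * T 1 1) / T 0 0).eval y)) *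
          (T 0 1 * C ((T 1 0).eval y) - C ((T 0 1).eval y) * T 1 0)
      + ((X ^ k * T 0 1) / T 0 0 - C (((X ^ k * T 0 1) / T 0 0).eval y)) *
          (T 1 0 * C ((T 1 1).eval y) - C ((T 1 0).eval y) * T 1 1)
      + ((X ^ k * T 1 0) / T 0 0 - C (((X ^ k * T 1 0) / T 0 0).eval y)) *
          (C ((T 0 1).eval y) * T 1 1 - T 0 1 * C ((T 1 1).eval y)))) ?_ x
  · simpa only [eval_mul, eval_add, eval_sub, eval_C, rho] using key
  · intro x
    simp only [eval_mul, eval_add, eval_sub, eval_C]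
    have hAD := h.AD hA x y
    have hBD := h.BD hA x y
    have hCD := h.CD hA x y
    simp only [rho] at hAD hBD hCD
    linear_combination (x - y) * h.casimir (1, 1) x y + (T 1 0).eval x * hBD
      + (T 0 1).eval x * hCD - (T 1 1).eval x * hAD

theorem matrix_eq_rsForm (h : EntryBrackets η k T F) (hA : T 0 0 ≠ 0) {x y : ℂ} (hxy : x ≠ y) :
    (Matrix.of fun p q => F (p.1, q.1) (p.2, q.2) x y) = rsForm η k T x y := by
  have hne : x - y ≠ 0 := sub_ne_zero.2 hxy
  have hdiv : ∀ {u v : ℂ}, (x - y) * u = η * v → u = η / (x - y) * v := by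
    intro u v huv
    field_simp
    linear_combination huv
  rw [rsForm_eq]
  ext ⟨i, j⟩ ⟨p, q⟩
  simp only [Matrix.of_apply, Matrix.smul_apply, smul_eq_mul, entryTable, ofArray_apply]
  -- The entry `((i, j), (p, q))` pairs `T i p` with `T j q`; splitting in this order groups the
  -- goals by the first of them.
  fin_cases i <;> fin_cases p <;> fin_cases j <;> fin_cases q
  · simpa using h.AA x y
  · exact hdiv (h.AB x y)
  · exact hdiv (h.AC x y)
  · exact hdiv (h.AD hA x y)
  · exact hdiv (h.BA x y)
  · simpa using h.BB x y
  · exact hdiv (h.BC x y)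
  · exact hdiv (h.BD hA x y)
  · exact hdiv (h.CA x y)
  · exact hdiv (h.CB x y)
  · simpa using h.CC x y
  · exact hdiv (h.CD hA x y)
  · exact hdiv (h.DA hA x y)
  · exact hdiv (h.DB hA x y)
  · exact hdiv (h.DC hA x y)
  · exact hdiv (h.DD hA x y)

end EntryBrackets

end EntryBrackets

/-! ### The brackets of the entries as sums over the nodes. -/

section NodeSums

variable {n : ℕ} {α β γ δ η : ℂ} {d : ℂ[X]} {z : Fin n ⊕ Fin n → ℂ}

/-- Interpolating at the roots of `A` is reduction modulo `A`; the Euclidean quotients of the `r`-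
and `s`-matrices enter here. -/
theorem sum_eval_node_mul_basisPoly (hα : α ≠ 0) (hz : z ∈ domain n) (Z : ℂ[X]) (x : ℂ) :
    ∑ i, Z.eval (z (Sum.inl i)) * (basisPoly α z i).eval x =
      Z.eval x - (polyA α z).eval x * (Z / polyA α z).eval x := by
  have hdiv : ∀ t, Z.eval t - (polyA α z).eval t * (Z / polyA α z).eval t =
      (Z % polyA α z).eval t := fun t => by
    nth_rewrite 1 [← EuclideanDomain.div_add_mod Z (polyA α z)]
    rw [eval_add, eval_mul, add_sub_cancel_left]
  have hdeg : (Z % polyA α z).degree < n :=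
    (Polynomial.degree_mod_lt _ (polyA_ne_zero hα z)).trans_le (degree_polyA hα z).le
  rw [hdiv, eq_sum_basisPoly hα hz hdeg, eval_finsetSum]
  refine Finset.sum_congr rfl fun i _ => ?_
  rw [eval_mul, eval_C, ← hdiv, eval_polyA_node, zero_mul, sub_zero]

/-- The symmetric kernel `∑ λ_i^k Y(λ_i) A'(λ_i) L_i(x) L_i(y)`. -/
noncomputable def nodeKernel (α : ℂ) (z : Fin n ⊕ Fin n → ℂ) (k : ℕ) (Y : ℂ[X]) (x y : ℂ) : ℂ :=
  ∑ i, z (Sum.inl i) ^ k * (Y.eval (z (Sum.inl i)) *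
    ((derivative (polyA α z)).eval (z (Sum.inl i)) *
      ((basisPoly α z i).eval x * (basisPoly α z i).eval y)))

/-- With `A(t) = (t - λ_i) A'(λ_i) L_i(t)`, writing `y - x = (y - λ_i) - (x - λ_i)` splits each
summand into `A(y) L_i(x) - A(x) L_i(y)` times its weight, and both resulting sums are interpolants.
-/
theorem mul_nodeKernel (hα : α ≠ 0) (hz : z ∈ domain n) (k : ℕ) (Y : ℂ[X]) (x y : ℂ) :
    (y - x) * nodeKernel α z k Y x y =
      x ^ k * (polyA α z).eval y * Y.eval x - y ^ k * (polyA α z).eval x * Y.eval y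
        - (polyA α z).eval x * (polyA α z).eval y * rho k (polyA α z) Y x y := by
  have hA : ∀ i t, (polyA α z).eval t = (t - z (Sum.inl i)) *
      ((derivative (polyA α z)).eval (z (Sum.inl i)) * (basisPoly α z i).eval t) := by
    intro i t
    nth_rewrite 1 [← X_sub_C_mul_basisPoly hα hz i]
    simp
  have hsum : (y - x) * nodeKernel α z k Y x y =
      (polyA α z).eval y *
        ∑ i, (X ^ k * Y).eval (z (Sum.inl i)) * (basisPoly α z i).eval x
      - (polyA α z).eval x *
        ∑ i, (X ^ k * Y).eval (z (Sum.inl i)) * (basisPoly α z i).eval y := by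
    rw [nodeKernel, Finset.mul_sum, Finset.mul_sum, Finset.mul_sum, ← Finset.sum_sub_distrib]
    refine Finset.sum_congr rfl fun i _ => ?_
    rw [hA i x, hA i y, eval_mul, eval_pow, eval_X]
    ring
  rw [hsum, sum_eval_node_mul_basisPoly hα hz, sum_eval_node_mul_basisPoly hα hz, rho]
  simp only [eval_mul, eval_pow, eval_X]
  ring

theorem diagBracket_polyA_polyB (hα : α ≠ 0) (hz : z ∈ domain n) (k : ℕ) (x y : ℂ) :
    diagBracket (X ^ k) (fun w => (polyA α w).eval x) (fun w => (polyB α β η w).eval y) z =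
      η * nodeKernel α z k (polyB α β η z) x y := by
  rw [diagBracket, nodeKernel, Finset.mul_sum]
  refine Finset.sum_congr rfl fun i _ => ?_
  rw [(pderiv_eval_polyA hα hz x i).1, (pderiv_eval_polyA hα hz x i).2,
    (pderiv_eval_polyB hα hz y i).2, eval_pow, eval_X]
  ring

theorem diagBracket_polyA_polyC (hα : α ≠ 0) (hz : z ∈ domain n) (k : ℕ) (x y : ℂ) :
    diagBracket (X ^ k) (fun w => (polyA α w).eval x) (fun w => (polyC α γ η d w).eval y) z =
      -(η * nodeKernel α z k (polyC α γ η d z) x y) := by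
  rw [diagBracket, nodeKernel, Finset.mul_sum, ← Finset.sum_neg_distrib]
  refine Finset.sum_congr rfl fun i _ => ?_
  rw [(pderiv_eval_polyA hα hz x i).1, (pderiv_eval_polyA hα hz x i).2,
    (pderiv_eval_polyC hα hz y i).2, eval_pow, eval_X]
  ring

theorem diagBracket_polyA_polyA (hα : α ≠ 0) (hz : z ∈ domain n) (k : ℕ) (x y : ℂ) :
    diagBracket (X ^ k) (fun w => (polyA α w).eval x) (fun w => (polyA α w).eval y) z = 0 :=
  Finset.sum_eq_zero fun i _ => by
    rw [(pderiv_eval_polyA hα hz x i).2, (pderiv_eval_polyA hα hz y i).2]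
    ring

/-- For each `i`, the derivatives of `B(x)` and `B(y)` in `(λ_i, μ_i)` are proportional to one
vector independent of `x` and `y`. The same holds for `C`. -/
theorem diagBracket_polyB_polyB (hα : α ≠ 0) (hz : z ∈ domain n) (k : ℕ) (x y : ℂ) :
    diagBracket (X ^ k) (fun w => (polyB α β η w).eval x) (fun w => (polyB α β η w).eval y) z =
      0 :=
  Finset.sum_eq_zero fun i _ => by
    rw [(pderiv_eval_polyB hα hz x i).1, (pderiv_eval_polyB hα hz y i).1,
      (pderiv_eval_polyB hα hz x i).2, (pderiv_eval_polyB hα hz y i).2]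
    ring

theorem diagBracket_polyC_polyC (hα : α ≠ 0) (hz : z ∈ domain n) (k : ℕ) (x y : ℂ) :
    diagBracket (X ^ k) (fun w => (polyC α γ η d w).eval x)
      (fun w => (polyC α γ η d w).eval y) z = 0 :=
  Finset.sum_eq_zero fun i _ => by
    rw [(pderiv_eval_polyC hα hz x i).1, (pderiv_eval_polyC hα hz y i).1,
      (pderiv_eval_polyC hα hz x i).2, (pderiv_eval_polyC hα hz y i).2]
    ring

/-- Derivative of `A D = d + B C` at a zero of `A`. It makes `D` appear in the bracket of `B` with
`C`. -/
theorem eval_derivative_det_node (hα : α ≠ 0) (hz : z ∈ domain n) (i : Fin n) :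
    (derivative (polyA α z)).eval (z (Sum.inl i)) *
        (polyD α β γ η d z).eval (z (Sum.inl i)) =
      (derivative d).eval (z (Sum.inl i))
      + (derivative (polyB α β η z)).eval (z (Sum.inl i)) *
        (polyC α γ η d z).eval (z (Sum.inl i))
      + (polyB α β η z).eval (z (Sum.inl i)) *
        (derivative (polyC α γ η d z)).eval (z (Sum.inl i)) := by
  have h := congrArg (fun p => (derivative p).eval (z (Sum.inl i)))
    (polyA_mul_polyD (β := β) (γ := γ) (η := η) (d := d) hα hz)
  simp only [derivative_mul, derivative_add, eval_add, eval_mul, eval_polyA_node, zero_mul,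
    add_zero] at h
  rw [h, add_assoc]

theorem diagBracket_polyB_polyC (hα : α ≠ 0) (hz : z ∈ domain n) (k : ℕ) (x y : ℂ) :
    diagBracket (X ^ k) (fun w => (polyB α β η w).eval x)
      (fun w => (polyC α γ η d w).eval y) z =
      -(η * nodeKernel α z k (polyD α β γ η d z) x y) := by
  rw [diagBracket, nodeKernel, Finset.mul_sum, ← Finset.sum_neg_distrib]
  refine Finset.sum_congr rfl fun i _ => ?_
  have hdet := eval_derivative_det_node (β := β) (γ := γ) (η := η) (d := d) hα hz i
  -- This absorbs the exponential in the `d'` term of the derivative of `C`, leaving the combination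
  -- found in `hdet`.
  have hB : (polyB α β η z).eval (z (Sum.inl i)) * Complex.exp (η * z (Sum.inr i)) = 1 := by
    rw [eval_polyB_node hα hz, ← Complex.exp_add, neg_add_cancel, Complex.exp_zero]
  rw [(pderiv_eval_polyB hα hz x i).1, (pderiv_eval_polyC hα hz y i).1,
    (pderiv_eval_polyB hα hz x i).2, (pderiv_eval_polyC hα hz y i).2, eval_pow, eval_X]
  generalize (basisPoly α z i).eval x = L at *
  generalize (basisPoly α z i).eval y = M at *
  linear_combination (-(η * z (Sum.inl i) ^ k * L * M)) * (derivative d).eval (z (Sum.inl i)) * hB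
    + (η * z (Sum.inl i) ^ k * L * M) * hdet

theorem exists_eval_eq_diagBracket_polyD (hα : α ≠ 0) (hd : d.natDegree ≤ 2 * n)
    (hz : z ∈ domain n) (φ : ℂ[X]) (g : (Fin n ⊕ Fin n → ℂ) → ℂ) :
    ∃ p : ℂ[X], ∀ x, diagBracket φ (fun w => (polyD α β γ η d w).eval x) g z = p.eval x := by
  have h := fun a x => pderiv_eval_family (isOpen_domain n)
    (coeffAnalyticOn_polyD (β := β) (γ := γ) (η := η) hα hd)
    (fun _ _ => natDegree_polyD_le hα hd) hz a x
  refine ⟨∑ i, C (φ.eval (z (Sum.inl i))) *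
    (coeffPderiv n (Sum.inl i) (fun w => polyD α β γ η d w) z * C (pderiv (Sum.inr i) g z)
      - coeffPderiv n (Sum.inr i) (fun w => polyD α β γ η d w) z * C (pderiv (Sum.inl i) g z)),
    fun x => ?_⟩
  simp [diagBracket, h, eval_finsetSum]

/-- Bracket of both sides of `A D = d + B C`, valid near `z`; `d(x)` does not depend on the point
and contributes nothing. -/
theorem mul_diagBracket_polyD (hα : α ≠ 0) (hd : d.natDegree ≤ 2 * n)
    (hz : z ∈ domain n) (φ : ℂ[X]) (g : (Fin n ⊕ Fin n → ℂ) → ℂ) (x : ℂ) :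
    (polyA α z).eval x * diagBracket φ (fun w => (polyD α β γ η d w).eval x) g z =
      (polyC α γ η d z).eval x * diagBracket φ (fun w => (polyB α β η w).eval x) g z
      + (polyB α β η z).eval x * diagBracket φ (fun w => (polyC α γ η d w).eval x) g z
      - (polyD α β γ η d z).eval x * diagBracket φ (fun w => (polyA α w).eval x) g z := by
  have hT := fun i j => ((analyticOnNhd_eval_matT (β := β) (γ := γ) (η := η) hα hd i j x) z
    hz).differentiableAt
  have hA : DifferentiableAt ℂ (fun w => (polyA α w).eval x) z := hT 0 0
  have hB : DifferentiableAt ℂ (fun w => (polyB α β η w).eval x) z := hT 0 1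
  have hC : DifferentiableAt ℂ (fun w => (polyC α γ η d w).eval x) z := hT 1 0
  have hD : DifferentiableAt ℂ (fun w => (polyD α β γ η d w).eval x) z := hT 1 1
  have h : (fun w => (polyA α w).eval x * (polyD α β γ η d w).eval x) =ᶠ[nhds z]
      fun w => d.eval x + (polyB α β η w).eval x * (polyC α γ η d w).eval x := by
    filter_upwards [(isOpen_domain n).mem_nhds hz] with w hw
    rw [← eval_mul, polyA_mul_polyD hα hw, eval_add, eval_mul]
  have h' := diagBracket_congr_left φ h g
  rw [diagBracket_mul_left φ hA hD, diagBracket_add_left φ (differentiableAt_const _)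
    (hB.fun_mul hC), diagBracket_const_left, diagBracket_mul_left φ hB hC] at h'
  linear_combination h'

theorem entryBrackets_matT (hα : α ≠ 0) (hd : d.natDegree ≤ 2 * n) (hz : z ∈ domain n) (k : ℕ) :
    EntryBrackets η k (matT α β γ η d z) fun s t x y =>
      diagBracket (X ^ k) (fun w => (matT α β γ η d w s.1 s.2).eval x)
        (fun w => (matT α β γ η d w t.1 t.2).eval y) z where
  skew _ _ _ _ := diagBracket_skew _ _ _ _
  poly _ _ := exists_eval_eq_diagBracket_polyD hα hd hz _ _
  casimir _ _ _ := mul_diagBracket_polyD hα hd hz _ _ _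
  AA x y := diagBracket_polyA_polyA hα hz k x y
  BB x y := diagBracket_polyB_polyB hα hz k x y
  CC x y := diagBracket_polyC_polyC hα hz k x y
  AB x y := by
    have h := diagBracket_polyA_polyB (β := β) (η := η) hα hz k x y
    have h' := mul_nodeKernel hα hz k (polyB α β η z) x y
    change (x - y) * diagBracket (X ^ k) (fun w => (polyA α w).eval x)
      (fun w => (polyB α β η w).eval y) z = η * (-(x ^ k * (polyA α z).eval y *
        (polyB α β η z).eval x) + y ^ k * (polyA α z).eval x * (polyB α β η z).eval y
        + (polyA α z).eval x * (polyA α z).eval y * rho k (polyA α z) (polyB α β η z) x y)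
    linear_combination (x - y) * h - η * h'
  AC x y := by
    have h := diagBracket_polyA_polyC (γ := γ) (η := η) (d := d) hα hz k x y
    have h' := mul_nodeKernel hα hz k (polyC α γ η d z) x y
    change (x - y) * diagBracket (X ^ k) (fun w => (polyA α w).eval x)
      (fun w => (polyC α γ η d w).eval y) z = η * (x ^ k * (polyA α z).eval y *
        (polyC α γ η d z).eval x - y ^ k * (polyA α z).eval x * (polyC α γ η d z).eval y
        - (polyA α z).eval x * (polyA α z).eval y * rho k (polyA α z) (polyC α γ η d z) x y)
    linear_combination (x - y) * h + η * h'
  BC x y := by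
    have h := diagBracket_polyB_polyC (β := β) (γ := γ) (η := η) (d := d) hα hz k x y
    have h' := mul_nodeKernel hα hz k (polyD α β γ η d z) x y
    change (x - y) * diagBracket (X ^ k) (fun w => (polyB α β η w).eval x)
      (fun w => (polyC α γ η d w).eval y) z = η * (x ^ k * (polyA α z).eval y *
        (polyD α β γ η d z).eval x - y ^ k * (polyA α z).eval x * (polyD α β γ η d z).eval y
        - (polyA α z).eval x * (polyA α z).eval y * rho k (polyA α z) (polyD α β γ η d z) x y)
    linear_combination (x - y) * h + η * h'

end NodeSums

end SklyaninFamily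

theorem proposition2 (n : ℕ) (η α β γ δ : ℂ) (hη : η ≠ 0) (hα : α ≠ 0)
    (d : ℂ[X]) (hd : d.natDegree ≤ 2 * n) (hd' : d.coeff (2 * n) = α * δ - β * γ) :
    -- the tensors `P_k = N^k P_0` and the brackets of the coordinates
    (∀ k ≤ n, ∀ z : Fin n ⊕ Fin n → ℂ,
      SklyaninFamily.poissonTensor n k z =
        Matrix.fromBlocks 0 (Matrix.diagonal fun i => z (Sum.inl i) ^ k)
          (-Matrix.diagonal fun i => z (Sum.inl i) ^ k) 0) ∧
    (∀ k ≤ n, ∀ z : Fin n ⊕ Fin n → ℂ, ∀ i j : Fin n,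
      SklyaninFamily.kBracket n k (fun w => w (Sum.inl i)) (fun w => w (Sum.inl j)) z = 0 ∧
      SklyaninFamily.kBracket n k (fun w => w (Sum.inr i)) (fun w => w (Sum.inr j)) z = 0 ∧
      SklyaninFamily.kBracket n k (fun w => w (Sum.inl i)) (fun w => w (Sum.inr j)) z =
        if i = j then z (Sum.inl i) ^ k else 0) ∧
    -- they are Poisson and pairwise compatible
    (∀ k ≤ n, SklyaninFamily.IsPoissonBracket (SklyaninFamily.kBracket n k)) ∧
    (∀ k ≤ n, ∀ l ≤ n,
      SklyaninFamily.Compatible (SklyaninFamily.kBracket n k) (SklyaninFamily.kBracket n l)) ∧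
    (∀ k ≤ n, ∀ l ≤ n, ∀ (z : Fin n ⊕ Fin n → ℂ) (a b c : Fin n ⊕ Fin n),
      SklyaninFamily.schouten (SklyaninFamily.poissonTensor n k)
        (SklyaninFamily.poissonTensor n l) z a b c = 0) ∧
    -- `T(λ)` has the required form and depends holomorphically on the coordinates
    (∀ z ∈ SklyaninFamily.domain n,
      (∀ i j, (SklyaninFamily.matT α β γ η d z i j).natDegree ≤ n) ∧
      (∀ i j, (SklyaninFamily.matT α β γ η d z i j).coeff n = !![α, β; γ, δ] i j) ∧
      (SklyaninFamily.matT α β γ η d z).det = d ∧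
      ∀ i : Fin n,
        (SklyaninFamily.matT α β γ η d z 0 0).eval (z (Sum.inl i)) = 0 ∧
        (SklyaninFamily.matT α β γ η d z 0 1).eval (z (Sum.inl i)) =
          Complex.exp (-(η * z (Sum.inr i)))) ∧
    (∀ (i j : Fin 2) (x : ℂ), AnalyticOnNhd ℂ
      (fun z => (SklyaninFamily.matT α β γ η d z i j).eval x) (SklyaninFamily.domain n)) ∧
    -- the brackets in matrix form
    (∀ k ≤ n, ∀ z ∈ SklyaninFamily.domain n, ∀ x y : ℂ, x ≠ y →
      SklyaninFamily.bracketMatrix (SklyaninFamily.kBracket n k)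
          (SklyaninFamily.matT α β γ η d) x y z =
        SklyaninFamily.rsForm η k (SklyaninFamily.matT α β γ η d z) x y) ∧
    -- for every `T`: `k = 0` is the Sklyanin bracket, `k = 1` the first nontrivial one
    (∀ T : Matrix (Fin 2) (Fin 2) ℂ[X], (∀ i j, (T i j).natDegree ≤ n) → (T 0 0).coeff n ≠ 0 →
      (∀ x y : ℂ, x ≠ y → SklyaninFamily.rsForm η 0 T x y = SklyaninFamily.sklyaninForm η T x y) ∧
      SklyaninFamily.IsFirstBracket η n T (SklyaninFamily.rsForm η 1 T)) := by
  refine ⟨fun k _ z => SklyaninFamily.poissonTensor_eq k z, fun k _ z i j => ?_, fun k _ => ?_,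
    fun k _ l _ a b => ?_, fun k _ l _ z a b c => SklyaninFamily.schouten_poissonTensor k l z a b c,
    fun z hz => ⟨fun i j => SklyaninFamily.natDegree_matT_le hα hd i j, fun i j => ?_,
      SklyaninFamily.det_matT hα hz, fun i =>
        ⟨SklyaninFamily.eval_polyA_node α z i, SklyaninFamily.eval_polyB_node hα hz i⟩⟩,
    fun i j x => SklyaninFamily.analyticOnNhd_eval_matT hα hd i j x, fun k _ z hz x y hxy => ?_,
    fun T hT hT' => ⟨fun x y _ => SklyaninFamily.rsForm_zero_eq_sklyaninForm hT hT' η x y,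
      SklyaninFamily.isFirstBracket_rsForm hT hT' η⟩⟩
  · rw [SklyaninFamily.kBracket_eq]
    simp only [SklyaninFamily.diagBracket, SklyaninFamily.pderiv_coord, Sum.inl.injEq,
      Sum.inr.injEq, reduceCtorEq, if_false, mul_zero, zero_mul, sub_self, sub_zero,
      Finset.sum_const_zero, true_and, eval_pow, eval_X]
    rw [Finset.sum_eq_single i (fun x _ hx => by simp [hx]) (by simp)]
    simp
  · rw [SklyaninFamily.kBracket_eq]
    exact SklyaninFamily.isPoissonBracket_diagBracket _
  · simp only [SklyaninFamily.kBracket_eq, SklyaninFamily.diagBracket_combination]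
    exact SklyaninFamily.isPoissonBracket_diagBracket _
  · fin_cases i <;> fin_cases j
    · exact SklyaninFamily.coeff_polyA α z
    · exact SklyaninFamily.coeff_polyB hα
    · exact SklyaninFamily.coeff_polyC hα
    · exact SklyaninFamily.coeff_polyD hα hd hd' hz
  · rw [SklyaninFamily.kBracket_eq]
    exact (SklyaninFamily.entryBrackets_matT hα hd hz k).matrix_eq_rsForm
      (SklyaninFamily.polyA_ne_zero hα z) hxy
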